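/- Let $k$ be an algebraically closed field of characteristic zero, let $\mathcal C$ be a finite semisimple $k$-linear (abelian) category, i.e. with finite-dimensional Hom spaces, finitely many isomorphism classes of simple objects, and every object a finite direct sum of simple objects, and let $\rho$ be an action of a finite group $G$ on $\mathcal C$ by $k$-linear autoequivalences $\rho^g$, with structure isomorphisms $\rho_2^{g,h}:\rho^g\rho^h\to\rho^{gh}$ and $\rho_0:\mathrm{id}_{\mathcal C}\to\rho^e$ satisfying the usual associativity and unit conditions. Let $\mathcal C^G$ be the equivariantization: its objects are pairs $(X,\mu)$ with isomorphisms $\mu^g:\rho^gX\to X$ such that $\mu^g\rho^g(\mu^h)=\mu^{gh}(\rho_2^{g,h})_X$ and $\mu^e(\rho_0)_X=\mathrm{id}_X$, and its morphisms $(X,\mu)\to(X',\mu')$ are the $f:X\to X'$ with $f\mu^g=\mu'^g\rho^g(f)$ for all $g\in G$. Let $Y$ be a simple object of $\mathcal C$, let $G_Y=\{g\in G:\rho^g(Y)\simeq Y\}$, choose isomorphisms $c^g:\rho^g(Y)\to Y$ for $g\in G_Y$, and let $\tilde\alpha_Y:G_Y\times G_Y\to k^*$ be defined by $\tilde\alpha_Y(g,h)^{-1}\mathrm{id}_Y=c^g\rho^g(c^h)(\rho_2^{g,h})_Y^{-1}(c^{gh})^{-1}$.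 A projective representation with factor set $\tilde\alpha_Y$ is a map $\pi:G_Y\to GL(V)$ with $\pi(g)\pi(h)=\tilde\alpha_Y(g,h)\pi(gh)$; two such are isomorphic if there is a linear isomorphism commuting with the actions. For $(X,\mu)\in\mathcal C^G$, the space $\mathrm{Hom}_{\mathcal C}(Y,X)$ is such a representation through $g\cdot f=\mu^g\rho^g(f)(c^g)^{-1}$. Let $\pi$ be an irreducible finite-dimensional projective representation of $G_Y$ on $V$ with factor set $\tilde\alpha_Y$, and let $\mathcal R$ be a set of representatives of the left cosets of $G_Y$ in $G$. Let $S_{Y,\pi}\in\mathcal C^G$ be the object $\bigoplus_{t\in\mathcal R}\rho^t(V\otimes Y)$ whose equivariant structure $\mu^g$ maps the summand $\rho^g\rho^t(V\otimes Y)$ to $\rho^r(V\otimes Y)$ by $\rho^r(\pi(h)\otimes c^h)\,(\rho_2^{r,h})^{-1}\rho_2^{g,t}$, where $gt=rh$ with $r\in\mathcal R$, $h\in G_Y$. Then $S_{Y,\pi}$ is a simple object of $\mathcal C^G$, and for every object $(X,\mu)$ of $\mathcal C^G$ $$\dim\mathrm{Hom}_{\mathcal C^G}(S_{Y,\pi},(X,\mu))=m_{G_Y}(\pi,\mathrm{Hom}_{\mathcal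 C}(Y,X)),$$ where $m_{G_Y}(\pi,\sigma)$, the multiplicity (intertwining number) of $\pi$ in $\sigma$, is the dimension of the space of linear maps $V_\pi\to V_\sigma$ commuting with the actions of $G_Y$. In particular, $S_{Y,\pi}$ is a constituent of $(X,\mu)$ (isomorphic to a direct summand in $\mathcal C^G$) if and only if $\pi$ is a constituent of $\mathrm{Hom}_{\mathcal C}(Y,X)$ (isomorphic to one of the summands in a decomposition of $\mathrm{Hom}_{\mathcal C}(Y,X)$ as a direct sum of irreducible projective representations with factor set $\tilde\alpha_Y$). -/

import Mathlib

open CategoryTheory CategoryTheory.Limits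

attribute [local instance] CategoryTheory.Abelian.hasFiniteBiproducts

universe w v u

namespace Equivariantization

/-- A finite semisimple `k`-linear category: a `k`-linear abelian category with finite-dimensional
Hom spaces and finitely many isomorphism classes of simple objects, in which every object is a
finite direct sum of simple objects. -/
class IsFiniteSemisimple (k : Type w) [Field k] (C : Type u) [Category.{v} C] [Abelian C]
    [Linear k C] : Prop where
  finiteDimensional_hom : ∀ X Y : C, FiniteDimensional k (X ⟶ Y)
  finite_simples : ∃ (n : ℕ) (S : Fin n → C), (∀ i, Simple (S i)) ∧
    ∀ Z : C, Simple Z → ∃ i, Nonempty (Z ≅ S i)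
  semisimple : ∀ X : C, ∃ (n : ℕ) (S : Fin n → C), (∀ i, Simple (S i)) ∧ Nonempty (X ≅ ⨁ S)

attribute [instance] IsFiniteSemisimple.finiteDimensional_hom

/-- An action of a group `G` on a `k`-linear category `C` by `k`-linear autoequivalences, i.e. a
monoidal functor from the discrete monoidal category `G` to the `k`-linear autoequivalences of `C`:
functors `ρ^g` with natural isomorphisms `ρ₂^{g,h} : ρ^g ρ^h ≅ ρ^{gh}` and `ρ₀ : id ≅ ρ^e` subject
to the associativity and unit constraints. (That each `ρ^g` is an equivalence is automatic, since
`ρ^g ρ^{g⁻¹} ≅ ρ^e ≅ id`.) The isomorphism `ρ₂^{g,h}` is written with a target `ρ^{gh}` in which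
the product is named by a third variable `gh` with `g * h = gh`; this avoids transports along
equalities such as `(a * b) * c = a * (b * c)` and adds no data. -/
structure LinearAction (k : Type w) [Field k] (G : Type*) [Group G] (C : Type u) [Category.{v} C]
    [Preadditive C] [Linear k C] where
  /-- the functor `ρ^g` -/
  obj : G → C ⥤ C
  additive : ∀ g, (obj g).Additive
  linear : ∀ g, (obj g).Linear k
  /-- the isomorphism `ρ₂^{g,h} : ρ^g ρ^h ≅ ρ^{gh}` -/
  mulIso : ∀ (g h gh : G), g * h = gh → (obj h ⋙ obj g ≅ obj gh)
  /-- the isomorphism `ρ₀ : id ≅ ρ^e` -/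
  oneIso : 𝟭 C ≅ obj 1
  assoc : ∀ (a b c ab bc abc : G) (hab : a * b = ab) (hbc : b * c = bc) (h₁ : ab * c = abc)
    (h₂ : a * bc = abc) (X : C),
    (mulIso a b ab hab).hom.app ((obj c).obj X) ≫ (mulIso ab c abc h₁).hom.app X =
      (obj a).map ((mulIso b c bc hbc).hom.app X) ≫ (mulIso a bc abc h₂).hom.app X
  mul_one_unit : ∀ (a : G) (X : C),
    (obj a).map (oneIso.hom.app X) ≫ (mulIso a 1 a (mul_one a)).hom.app X = 𝟙 ((obj a).obj X)
  one_mul_unit : ∀ (a : G) (X : C),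
    oneIso.hom.app ((obj a).obj X) ≫ (mulIso 1 a a (one_mul a)).hom.app X = 𝟙 ((obj a).obj X)

attribute [instance] LinearAction.additive LinearAction.linear

section Preadditive

variable {k : Type w} [Field k] {G : Type*} [Group G] {C : Type u} [Category.{v} C]
  [Preadditive C] [Linear k C]

namespace LinearAction

/-- The restriction of an action of `G` to a subgroup. -/
abbrev restrict (ρ : LinearAction k G C) (H : Subgroup G) : LinearAction k H C where
  obj h := ρ.obj h
  additive h := ρ.additive h
  linear h := ρ.linear h
  mulIso g h gh e := ρ.mulIso g h gh (by rw [← e]; rfl)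
  oneIso := ρ.oneIso
  assoc a b c ab bc abc hab hbc h₁ h₂ X := ρ.assoc a b c ab bc abc _ _ _ _ X
  mul_one_unit a X := ρ.mul_one_unit a X
  one_mul_unit a X := ρ.one_mul_unit a X

/-- The inertia subgroup `G_Y = {g ∈ G | ρ^g(Y) ≅ Y}`. -/
def inertia (ρ : LinearAction k G C) (Y : C) : Subgroup G where
  carrier := {g | Nonempty ((ρ.obj g).obj Y ≅ Y)}
  one_mem' := ⟨(ρ.oneIso.app Y).symm⟩
  mul_mem' := by
    rintro a b ⟨ea⟩ ⟨eb⟩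
    exact ⟨((ρ.mulIso a b _ rfl).app Y).symm ≪≫ (ρ.obj a).mapIso eb ≪≫ ea⟩
  inv_mem' := by
    rintro a ⟨ea⟩
    exact ⟨(ρ.obj a⁻¹).mapIso ea.symm ≪≫ (ρ.mulIso a⁻¹ a 1 (inv_mul_cancel a)).app Y ≪≫
      (ρ.oneIso.app Y).symm⟩

end LinearAction

/-- A `G`-equivariant object `(X, μ)` of `C`: an object of the equivariantization `C^G`. -/
structure EquivObj (ρ : LinearAction k G C) where
  X : C
  /-- the isomorphisms `μ^g : ρ^g X ≅ X` -/
  μ : ∀ g : G, (ρ.obj g).obj X ≅ X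
  mul : ∀ (g h gh : G) (e : g * h = gh),
    (ρ.obj g).map (μ h).hom ≫ (μ g).hom = (ρ.mulIso g h gh e).hom.app X ≫ (μ gh).hom
  one : ρ.oneIso.hom.app X ≫ (μ 1).hom = 𝟙 X

namespace EquivObj

variable {ρ : LinearAction k G C}

/-- The space of morphisms `(X, μ) ⟶ (X', μ')` in `C^G`: all `f : X ⟶ X'` such that
`f μ^g = μ'^g ρ^g(f)` for all `g`. -/
def homSubmodule (A B : EquivObj ρ) : Submodule k (A.X ⟶ B.X) where
  carrier := {f | ∀ g, (A.μ g).hom ≫ f = (ρ.obj g).map f ≫ (B.μ g).hom}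
  add_mem' := by
    intro f f' hf hf' g
    simp only [Set.mem_ofPred_eq] at hf hf'
    simp [hf g, hf' g, Functor.map_add]
  zero_mem' := by intro g; simp
  smul_mem' := by
    intro a f hf g
    simp only [Set.mem_ofPred_eq] at hf
    simp [hf g, Functor.map_smul]

/-- The equivariantization `C^G`. -/
instance : Category (EquivObj ρ) where
  Hom A B := homSubmodule A B
  id A := ⟨𝟙 A.X, fun g => by simp⟩
  comp f f' := ⟨f.1 ≫ f'.1, fun g => by
    have h := f.2 g
    have h' := f'.2 g
    rw [← Category.assoc, h, Category.assoc, h', Functor.map_comp, Category.assoc]⟩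
  id_comp f := Subtype.ext (Category.id_comp f.1)
  comp_id f := Subtype.ext (Category.comp_id f.1)
  assoc f g h := Subtype.ext (Category.assoc f.1 g.1 h.1)

instance : Preadditive (EquivObj ρ) where
  homGroup A B := inferInstanceAs (AddCommGroup (homSubmodule A B))
  add_comp _ _ _ f f' g := Subtype.ext (Preadditive.add_comp _ _ _ f.1 f'.1 g.1)
  comp_add _ _ _ f g g' := Subtype.ext (Preadditive.comp_add _ _ _ f.1 g.1 g'.1)

instance : Linear k (EquivObj ρ) where
  homModule A B := inferInstanceAs (Module k (homSubmodule A B))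
  smul_comp _ _ _ r f g := Subtype.ext (Linear.smul_comp _ _ _ r f.1 g.1)
  comp_smul _ _ _ f r g := Subtype.ext (Linear.comp_smul _ _ _ f.1 r g.1)

end EquivObj

/-- In a semisimple category, a simple object `S` is a constituent of `X` if `S` is isomorphic to a
direct summand of `X`. -/
def IsConstituent {D : Type*} [Category D] [HasZeroMorphisms D] (S X : D) : Prop :=
  Simple S ∧ Nonempty (Retract S X)

end Preadditive

section ProjectiveRepresentations

variable {k : Type*} [Field k] {H : Type*} [Group H]

/-- A projective representation of `H` on `V` with factor set `α`: a map `π : H → GL(V)` with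
`π(g) π(h) = α(g, h) π(gh)`. (Taking `g = h = 1` gives `π(1) = α(1, 1) id`, so `π(1) = id` as soon
as `α` is normalized.) -/
structure ProjRep (α : H → H → kˣ) (V : Type*) [AddCommGroup V] [Module k V] where
  toFun : H → (V ≃ₗ[k] V)
  mul : ∀ g h v, toFun g (toFun h v) = (α g h : k) • toFun (g * h) v

namespace ProjRep

variable {α : H → H → kˣ} {V W : Type*} [AddCommGroup V] [Module k V] [AddCommGroup W] [Module k W]

/-- A subspace invariant under all `π(g)`. -/
def IsInvariant (π : ProjRep α V) (U : Submodule k V) : Prop :=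
  ∀ g, ∀ x ∈ U, π.toFun g x ∈ U

/-- `U` is an irreducible subrepresentation of `π`: it is invariant and nonzero, and its only
invariant subspaces are `0` and `U`. -/
def IsIrreducibleSub (π : ProjRep α V) (U : Submodule k V) : Prop :=
  π.IsInvariant U ∧ U ≠ ⊥ ∧ ∀ U' : Submodule k V, U' ≤ U → π.IsInvariant U' → U' = ⊥ ∨ U' = U

/-- `π` is irreducible: `V ≠ 0`, and `0` and `V` are the only invariant subspaces. -/
def IsIrreducible (π : ProjRep α V) : Prop := π.IsIrreducibleSub ⊤

/-- The space `Hom(π, σ)` of homomorphisms of modules over the twisted group algebra, i.e. of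
linear maps commuting with the actions. -/
def intertwiners (π : ProjRep α V) (σ : ProjRep α W) : Submodule k (V →ₗ[k] W) where
  carrier := {φ | ∀ g v, φ (π.toFun g v) = σ.toFun g (φ v)}
  add_mem' := by
    intro φ ψ hφ hψ g v
    simp only [Set.mem_ofPred_eq] at hφ hψ
    simp [hφ, hψ]
  zero_mem' := by intro g v; simp
  smul_mem' := by
    intro a φ hφ g v
    simp only [Set.mem_ofPred_eq] at hφ
    simp [hφ]

/-- The multiplicity (intertwining number) of an irreducible `π` in `σ`. -/
noncomputable def multiplicity (π : ProjRep α V) (σ : ProjRep α W) : ℕ :=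
  Module.finrank k (intertwiners π σ)

/-- `π` is a constituent of `σ`: in a decomposition of `σ` as an (internal) direct sum of
irreducible subrepresentations, one of the summands is isomorphic to `π`. -/
def IsConstituentOf (π : ProjRep α V) (σ : ProjRep α W) : Prop :=
  ∃ (n : ℕ) (U : Fin n → Submodule k W), DirectSum.IsInternal U ∧
    (∀ i, σ.IsIrreducibleSub (U i)) ∧
    ∃ (i : Fin n) (φ : V ≃ₗ[k] U i), ∀ g v, (φ (π.toFun g v) : W) = σ.toFun g (φ v)

end ProjRep

end ProjectiveRepresentations

section Biproducts

variable {C : Type u} [Category.{v} C] [Preadditive C] [HasFiniteBiproducts C]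
  {J : Type*} [Finite J]

/-- An additive functor commutes with finite direct sums. -/
noncomputable def mapSumIso (F : C ⥤ C) [F.Additive] (f : J → C) :
    F.obj (⨁ f) ≅ ⨁ fun j => F.obj (f j) where
  hom := biproduct.lift fun j => F.map (biproduct.π f j)
  inv := biproduct.desc fun j => F.map (biproduct.ι f j)
  hom_inv_id := by
    classical
    have := Fintype.ofFinite J
    have tot : ∑ j, biproduct.π f j ≫ biproduct.ι f j = 𝟙 (⨁ f) :=
      IsBilimit.total (biproduct.isBilimit f)
    have hι : ∀ i, F.map (biproduct.ι f i) ≫ biproduct.lift (fun j => F.map (biproduct.π f j)) =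
        biproduct.ι (fun j => F.obj (f j)) i := by
      intro i
      refine biproduct.hom_ext _ _ fun j => ?_
      simp only [Category.assoc, biproduct.lift_π, ← F.map_comp, biproduct.ι_π]
      split_ifs with h
      · subst h; simp
      · simp
    rw [← Category.id_comp (_ ≫ _), ← F.map_id, ← tot, F.map_sum, Preadditive.sum_comp]
    simp_rw [F.map_comp, Category.assoc]
    simp only [reassoc_of% hι, biproduct.ι_desc]
  inv_hom_id := by
    classical
    refine biproduct.hom_ext' _ _ fun i => biproduct.hom_ext _ _ fun j => ?_
    simp only [biproduct.ι_desc_assoc, Category.assoc, biproduct.lift_π, Category.comp_id,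
      ← F.map_comp, biproduct.ι_π]
    split_ifs with h
    · subst h; simp
    · simp

lemma map_ι_mapSumIso (F : C ⥤ C) [F.Additive] (f : J → C) (j : J) :
    F.map (biproduct.ι f j) ≫ (mapSumIso F f).hom = biproduct.ι (fun j => F.obj (f j)) j := by
  rw [← Iso.eq_comp_inv]
  simp [mapSumIso]

lemma map_biproduct_hom_ext (f : J → C) (F : C ⥤ C) [F.Additive] {Z : C} {a b : F.obj (⨁ f) ⟶ Z}
    (h : ∀ j, F.map (biproduct.ι f j) ≫ a = F.map (biproduct.ι f j) ≫ b) : a = b := by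
  rw [← cancel_epi (mapSumIso F f).inv]
  refine biproduct.hom_ext' _ _ fun j => ?_
  simpa [mapSumIso] using h j

end Biproducts

section Tensor

variable {k : Type*} [Field k] {C : Type u} [Category.{v} C] [Preadditive C] [Linear k C]
  [HasFiniteBiproducts C]

/-- The object `V ⊗ Y` for a finite-dimensional vector space `V`: a direct sum of copies of `Y`
indexed by a basis of `V`. -/
noncomputable abbrev tensorObj (k : Type*) [Field k] (V : Type*) [AddCommGroup V] [Module k V]
    (Y : C) : C :=
  ⨁ fun _ : Fin (Module.finrank k V) => Y

variable {V : Type*} [AddCommGroup V] [Module k V] [FiniteDimensional k V]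

/-- The morphism `v ⊗ - : Y ⟶ V ⊗ Y` attached to a vector `v`, linear in `v`. -/
noncomputable def tensorι (Y : C) : V →ₗ[k] (Y ⟶ tensorObj k V Y) :=
  (Module.finBasis k V).constr k fun i =>
    biproduct.ι (fun _ : Fin (Module.finrank k V) => Y) i

/-- The morphism `T ⊗ c : V ⊗ Y ⟶ V ⊗ Z`, determined by `(T ⊗ c)(v ⊗ -) = (T v ⊗ -) c`. -/
noncomputable def tensorMap (T : V →ₗ[k] V) {Y Z : C} (c : Y ⟶ Z) :
    tensorObj k V Y ⟶ tensorObj k V Z :=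
  biproduct.desc fun i => c ≫ tensorι Z (T (Module.finBasis k V i))

lemma tensorι_basis (Y : C) (i : Fin (Module.finrank k V)) :
    tensorι Y (Module.finBasis k V i) =
      biproduct.ι (fun _ : Fin (Module.finrank k V) => Y) i := by
  exact (Module.finBasis k V).constr_basis k _ i

lemma tensorι_tensorMap (T : V →ₗ[k] V) {Y Z : C} (c : Y ⟶ Z) (v : V) :
    tensorι Y v ≫ tensorMap T c = c ≫ tensorι Z (T v) := by
  have : (Linear.rightComp k Y (tensorMap T c)) ∘ₗ (tensorι Y : V →ₗ[k] _) =
      (Linear.leftComp k (tensorObj k V Z) c) ∘ₗ tensorι Z ∘ₗ T := by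
    refine (Module.finBasis k V).ext fun i => ?_
    simp only [LinearMap.comp_apply, Linear.rightComp_apply, Linear.leftComp_apply, tensorι_basis]
    simp [tensorMap]
  exact LinearMap.congr_fun this v

lemma tensor_hom_ext {Y Z : C} {a b : tensorObj k V Y ⟶ Z}
    (h : ∀ v : V, tensorι Y v ≫ a = tensorι Y v ≫ b) : a = b := by
  refine biproduct.hom_ext' _ _ fun i => ?_
  have := h (Module.finBasis k V i)
  rwa [tensorι_basis] at this

/-- The isomorphism `T ⊗ c : V ⊗ Y ≅ V ⊗ Z`. -/
noncomputable def tensorIso (T : V ≃ₗ[k] V) {Y Z : C} (c : Y ≅ Z) :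
    tensorObj k V Y ≅ tensorObj k V Z where
  hom := tensorMap T.toLinearMap c.hom
  inv := tensorMap T.symm.toLinearMap c.inv
  hom_inv_id := tensor_hom_ext (k := k) fun v => by
    rw [← Category.assoc, tensorι_tensorMap, Category.assoc, tensorι_tensorMap]
    simp
  inv_hom_id := tensor_hom_ext (k := k) fun v => by
    rw [← Category.assoc, tensorι_tensorMap, Category.assoc, tensorι_tensorMap]
    simp

/-- A `k`-linear functor preserves `V ⊗ Y`. -/
noncomputable def mapTensorIso (F : C ⥤ C) [F.Additive] (Y : C) :
    F.obj (tensorObj k V Y) ≅ tensorObj k V (F.obj Y) :=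
  mapSumIso F fun _ : Fin (Module.finrank k V) => Y

lemma map_tensorι_mapTensorIso (F : C ⥤ C) [F.Additive] [F.Linear k] (Y : C) (v : V) :
    F.map (tensorι Y v) ≫ (mapTensorIso (k := k) (V := V) F Y).hom = tensorι (F.obj Y) v := by
  have : (Linear.rightComp k (F.obj Y) (mapTensorIso (k := k) (V := V) F Y).hom) ∘ₗ
      (F.mapLinearMap k) ∘ₗ (tensorι Y : V →ₗ[k] _) = tensorι (F.obj Y) := by
    refine (Module.finBasis k V).ext fun i => ?_
    simp only [LinearMap.comp_apply, Linear.rightComp_apply, tensorι_basis,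
      Functor.mapLinearMap_apply]
    exact map_ι_mapSumIso F _ i
  exact LinearMap.congr_fun this v

lemma map_tensor_hom_ext (F : C ⥤ C) [F.Additive] [F.Linear k] {Y Z : C}
    {a b : F.obj (tensorObj k V Y) ⟶ Z}
    (h : ∀ v : V, F.map (tensorι Y v) ≫ a = F.map (tensorι Y v) ≫ b) : a = b := by
  rw [← cancel_epi (mapTensorIso (k := k) (V := V) F Y).inv]
  refine tensor_hom_ext (k := k) (V := V) fun v => ?_
  rw [← map_tensorι_mapTensorIso]
  simpa using h v

end Tensor

section Main

variable {k : Type w} [Field k] {G : Type*} [Group G] {C : Type u} [Category.{v} C]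
  [Preadditive C] [Linear k C]

/-- For `g t = r h` with `h ∈ H`, the component `ρ^r(ν^h) (ρ₂^{r,h})⁻¹ ρ₂^{g,t} : ρ^g ρ^t N ≅ ρ^r N`
of the equivariant structure of the object of `C^G` induced from `(N, ν) ∈ C^H`. -/
def inducedComponent (ρ : LinearAction k G C) {H : Subgroup G}
    (N : EquivObj (ρ.restrict H)) (g t r : G) (h : H) (e : r * (h : G) = g * t) :
    (ρ.obj g).obj ((ρ.obj t).obj N.X) ≅ (ρ.obj r).obj N.X :=
  (ρ.mulIso g t (g * t) rfl).app N.X ≪≫ ((ρ.mulIso r h (g * t) e).app N.X).symm ≪≫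
    (ρ.obj r).mapIso (N.μ h)

lemma inducedComponent_mul (ρ : LinearAction k G C) {H : Subgroup G}
    (N : EquivObj (ρ.restrict H)) (a b ab t s r : G) (h₁ h₂ h₁₂ : H) (hab : a * b = ab)
    (e₁ : s * (h₁ : G) = b * t) (e₂ : r * (h₂ : G) = a * s) (e₁₂ : r * (h₁₂ : G) = ab * t) :
    (ρ.obj a).map (inducedComponent ρ N b t s h₁ e₁).hom ≫
        (inducedComponent ρ N a s r h₂ e₂).hom =
      (ρ.mulIso a b ab hab).hom.app ((ρ.obj t).obj N.X) ≫
        (inducedComponent ρ N ab t r h₁₂ e₁₂).hom := by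
  have hh : h₂ * h₁ = h₁₂ := by
    apply Subtype.ext
    apply mul_left_cancel (a := r)
    rw [e₁₂, Subgroup.coe_mul, ← mul_assoc, e₂, mul_assoc, e₁, ← hab, mul_assoc]
  have hN := N.mul h₂ h₁ h₁₂ hh
  have hhG : (h₂ : G) * (h₁ : G) = h₁₂ := by rw [← hh]; rfl
  change (ρ.obj h₂).map (N.μ h₁).hom ≫ (N.μ h₂).hom =
    (ρ.mulIso h₂ h₁ h₁₂ hhG).hom.app N.X ≫ (N.μ h₁₂).hom at hN
  have q₁ := ρ.assoc a b t ab (b * t) (ab * t) hab rfl rfl (by rw [← hab, mul_assoc]) N.X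
  have q₂ := ρ.assoc a s h₁ (a * s) (b * t) (ab * t) rfl e₁ (by rw [mul_assoc, e₁, ← hab, mul_assoc])
    (by rw [← hab, mul_assoc]) N.X
  have q₃ := ρ.assoc r h₂ h₁ (a * s) h₁₂ (ab * t) e₂ hhG
    (by rw [mul_assoc, e₁, ← hab, mul_assoc]) e₁₂ N.X
  have n₁ := (ρ.mulIso a s (a * s) rfl).hom.naturality (N.μ h₁).hom
  have n₂ := (ρ.mulIso r h₂ (a * s) e₂).hom.naturality (N.μ h₁).hom
  change (ρ.obj a).map ((ρ.obj s).map (N.μ h₁).hom) ≫ _ = _ at n₁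
  change (ρ.obj r).map ((ρ.obj h₂).map (N.μ h₁).hom) ≫ _ = _ at n₂
  have hN' : (ρ.obj r).map ((ρ.obj h₂).map (N.μ h₁).hom) ≫ (ρ.obj r).map (N.μ h₂).hom =
      (ρ.obj r).map ((ρ.mulIso h₂ h₁ h₁₂ hhG).hom.app N.X) ≫ (ρ.obj r).map (N.μ h₁₂).hom :=
    ((ρ.obj r).map_comp _ _).symm.trans ((congrArg (ρ.obj r).map hN).trans ((ρ.obj r).map_comp _ _))
  simp only [inducedComponent, Iso.trans_hom, Iso.symm_hom, Iso.app_hom, Iso.app_inv,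
    Functor.mapIso_hom, Functor.map_comp, Category.assoc]
  rw [reassoc_of% q₁]
  congr 1
  rw [← cancel_epi ((ρ.obj a).map ((ρ.mulIso s h₁ (b * t) e₁).hom.app N.X)), ← reassoc_of% q₂]
  rw [← Functor.map_comp_assoc, Iso.hom_inv_id_app]
  erw [(ρ.obj a).map_id, Category.id_comp, reassoc_of% n₁]
  congr 1
  rw [← cancel_epi ((ρ.mulIso r h₂ (a * s) e₂).hom.app ((ρ.obj h₁).obj N.X)), reassoc_of% q₃]
  erw [← reassoc_of% n₂]
  rw [Iso.hom_inv_id_app_assoc, Iso.hom_inv_id_app_assoc, ← hN']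

lemma inducedComponent_one (ρ : LinearAction k G C) {H : Subgroup G}
    (N : EquivObj (ρ.restrict H)) (r : G) (e : r * ((1 : H) : G) = 1 * r) :
    ρ.oneIso.hom.app ((ρ.obj r).obj N.X) ≫ (inducedComponent ρ N 1 r r 1 e).hom =
      𝟙 ((ρ.obj r).obj N.X) := by
  have u₁ := ρ.one_mul_unit r N.X
  have u₂ := ρ.mul_one_unit r N.X
  have hN := N.one
  change ρ.oneIso.hom.app N.X ≫ (N.μ 1).hom = 𝟙 N.X at hN
  simp only [inducedComponent, Iso.trans_hom, Iso.symm_hom, Iso.app_hom, Iso.app_inv]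
  have key : ∀ (x : G) (hx : 1 * r = x) (hx' : r * ((1 : H) : G) = x),
      ρ.oneIso.hom.app ((ρ.obj r).obj N.X) ≫ (ρ.mulIso 1 r x hx).hom.app N.X ≫
        (ρ.mulIso r ((1 : H) : G) x hx').inv.app N.X ≫ (ρ.obj r).map (N.μ 1).hom =
          𝟙 ((ρ.obj r).obj N.X) := by
    intro x hx hx'
    obtain rfl : r = x := by simpa using hx
    rw [reassoc_of% u₁]
    have : (ρ.mulIso r ((1 : H) : G) r hx').inv.app N.X = (ρ.obj r).map (ρ.oneIso.hom.app N.X) := by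
      rw [← cancel_mono ((ρ.mulIso r ((1 : H) : G) r hx').hom.app N.X), Iso.inv_hom_id_app]
      exact u₂.symm
    rw [this]
    erw [← Functor.map_comp, hN]
    exact (ρ.obj r).map_id N.X
  exact key _ rfl e

variable [HasFiniteBiproducts C] [Finite G]

/-- The element `h ∈ H` with `g t = r h`, where `t` and `r` are the chosen representatives of the
coset `q` and of the coset `g q`. -/
def cosetElement {H : Subgroup G} (s : G ⧸ H → G) (hs : ∀ q, (s q : G ⧸ H) = q) (g : G)
    (q : G ⧸ H) : H :=
  ⟨(s (g • q))⁻¹ * (g * s q), by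
    rw [← QuotientGroup.eq, hs]
    change g • q = g • (s q : G ⧸ H)
    rw [hs]⟩

/-- The isomorphism `μ^g` of the induced object `⨁_t ρ^t N`, mapping the summand `ρ^g ρ^t N` to the
summand `ρ^r N` where `r` is the representative of `g t H`. -/
noncomputable def inducedIso (ρ : LinearAction k G C) {H : Subgroup G} (s : G ⧸ H → G)
    (hs : ∀ q, (s q : G ⧸ H) = q) (N : EquivObj (ρ.restrict H)) (g : G) :
    (ρ.obj g).obj (⨁ fun q : G ⧸ H => (ρ.obj (s q)).obj N.X) ≅
      ⨁ fun q : G ⧸ H => (ρ.obj (s q)).obj N.X :=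
  mapSumIso (ρ.obj g) (fun q : G ⧸ H => (ρ.obj (s q)).obj N.X) ≪≫
    biproduct.whiskerEquiv (f := fun q : G ⧸ H => (ρ.obj g).obj ((ρ.obj (s q)).obj N.X))
      (g := fun q : G ⧸ H => (ρ.obj (s q)).obj N.X) (MulAction.toPerm g) fun q =>
      (inducedComponent ρ N g (s q) (s (g • q)) (cosetElement s hs g q)
        (by simp [cosetElement])).symm

lemma map_ι_inducedIso (ρ : LinearAction k G C) {H : Subgroup G} (s : G ⧸ H → G)
    (hs : ∀ q, (s q : G ⧸ H) = q) (N : EquivObj (ρ.restrict H)) (g : G) (q : G ⧸ H) :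
    (ρ.obj g).map (biproduct.ι (fun q : G ⧸ H => (ρ.obj (s q)).obj N.X) q) ≫
        (inducedIso ρ s hs N g).hom =
      (inducedComponent ρ N g (s q) (s (g • q)) (cosetElement s hs g q)
        (by simp [cosetElement])).hom ≫
        biproduct.ι (fun q : G ⧸ H => (ρ.obj (s q)).obj N.X) (g • q) := by
  rw [inducedIso, Iso.trans_hom, ← Category.assoc, map_ι_mapSumIso]
  exact biproduct.ι_desc _ _

lemma inducedComponent_ι (ρ : LinearAction k G C) {H : Subgroup G} (s : G ⧸ H → G)
    (N : EquivObj (ρ.restrict H)) (g t : G) {q q' : G ⧸ H} (hq : q = q') (h h' : H)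
    (e : s q * (h : G) = g * t) (e' : s q' * (h' : G) = g * t) :
    (inducedComponent ρ N g t (s q) h e).hom ≫
        biproduct.ι (fun q : G ⧸ H => (ρ.obj (s q)).obj N.X) q =
      (inducedComponent ρ N g t (s q') h' e').hom ≫
        biproduct.ι (fun q : G ⧸ H => (ρ.obj (s q)).obj N.X) q' := by
  subst hq
  obtain rfl : h = h' := Subtype.ext (mul_left_cancel (e.trans e'.symm))
  rfl

/-- The left adjoint `L : C^H → C^G` of the restriction functor, on objects, for a subgroup `H`
and a family `s` of representatives of the left cosets of `H`: `L(N, ν) = (⨁_t ρ^t N, μ)`. -/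
noncomputable def induced (ρ : LinearAction k G C) {H : Subgroup G} (s : G ⧸ H → G)
    (hs : ∀ q, (s q : G ⧸ H) = q) (N : EquivObj (ρ.restrict H)) : EquivObj ρ where
  X := ⨁ fun q : G ⧸ H => (ρ.obj (s q)).obj N.X
  μ := inducedIso ρ s hs N
  mul := by
    intro a b ab hab
    refine map_biproduct_hom_ext _ (ρ.obj b ⋙ ρ.obj a) fun q => ?_
    rw [Functor.comp_map]
    have n : (ρ.obj a).map ((ρ.obj b).map
        (biproduct.ι (fun q : G ⧸ H => (ρ.obj (s q)).obj N.X) q)) ≫ _ = _ :=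
      (ρ.mulIso a b ab hab).hom.naturality
      (biproduct.ι (fun q : G ⧸ H => (ρ.obj (s q)).obj N.X) q)
    have e₁ : s (b • q) * (cosetElement s hs b q : G) = b * s q := by simp [cosetElement]
    have e₂ : s (a • b • q) * (cosetElement s hs a (b • q) : G) = a * s (b • q) := by
      simp [cosetElement]
    have e₁₂ : s (a • b • q) * ((cosetElement s hs a (b • q) * cosetElement s hs b q : H) : G) =
        ab * s q := by
      rw [Subgroup.coe_mul, ← mul_assoc, e₂, mul_assoc, e₁, ← hab, mul_assoc]
    have hl : (ρ.obj a).map ((ρ.obj b).map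
          (biproduct.ι (fun q : G ⧸ H => (ρ.obj (s q)).obj N.X) q)) ≫
        (ρ.obj a).map (inducedIso ρ s hs N b).hom =
        (ρ.obj a).map (inducedComponent ρ N b (s q) (s (b • q)) (cosetElement s hs b q) e₁).hom ≫
          (ρ.obj a).map (biproduct.ι (fun q : G ⧸ H => (ρ.obj (s q)).obj N.X) (b • q)) := by
      rw [← Functor.map_comp, map_ι_inducedIso, Functor.map_comp]
    rw [reassoc_of% hl, map_ι_inducedIso]
    erw [reassoc_of% n]
    rw [map_ι_inducedIso, inducedComponent_ι ρ s N ab (s q) (by rw [← hab, mul_smul])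
      (cosetElement s hs ab q) _ _ e₁₂]
    rw [← Category.assoc, ← Category.assoc,
      inducedComponent_mul ρ N a b ab (s q) (s (b • q)) (s (a • b • q)) _ _ _ hab e₁ e₂ e₁₂]
  one := by
    refine biproduct.hom_ext' _ _ fun q => ?_
    have n := ρ.oneIso.hom.naturality
      (biproduct.ι (fun q : G ⧸ H => (ρ.obj (s q)).obj N.X) q)
    erw [reassoc_of% n]
    rw [map_ι_inducedIso, inducedComponent_ι ρ s N 1 (s q) (one_smul G q)
      (cosetElement s hs 1 q) 1 _ (by simp), ← Category.assoc, inducedComponent_one]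
    simp

end Main

section SimpleObjects

variable {k : Type w} [Field k] [IsAlgClosed k] {G : Type*} [Group G] {C : Type u}
  [Category.{v} C] [Abelian C] [Linear k C] [IsFiniteSemisimple k C]

/-- For a simple object `Y`, an automorphism of `Y` is multiplication by a unique nonzero scalar,
written as `a⁻¹`. -/
lemma existsUnique_inv_smul_id (k : Type w) [Field k] [IsAlgClosed k] [Linear k C]
    [IsFiniteSemisimple k C] {Y : C} [Simple Y] (e : Y ≅ Y) :
    ∃! a : kˣ, ((a⁻¹ : kˣ) : k) • 𝟙 Y = e.hom := by
  obtain ⟨b, hb⟩ := endomorphism_simple_eq_smul_id k e.hom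
  have hb0 : b ≠ 0 := by
    rintro rfl
    apply id_nonzero Y
    rw [← e.hom_inv_id, ← hb]
    simp
  refine ⟨(Units.mk0 b hb0)⁻¹, by simpa using hb, fun a ha => ?_⟩
  have h0 : (((a⁻¹ : kˣ) : k) - b) • 𝟙 Y = 0 := by
    rw [sub_smul, hb]
    exact sub_eq_zero.mpr ha
  have h1 : ((a⁻¹ : kˣ) : k) = b :=
    sub_eq_zero.mp ((smul_eq_zero.mp h0).resolve_right (id_nonzero Y))
  rw [← inv_inv a]
  congr 1
  exact Units.ext h1

variable (ρ : LinearAction k G C) (Y : C)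

/-- The automorphism `c^g ρ^g(c^h) (ρ₂^{g,h})⁻¹ (c^{gh})⁻¹` of `Y`, for `g, h ∈ G_Y`. -/
def obstruction (c : ∀ g : ρ.inertia Y, (ρ.obj g).obj Y ≅ Y) (g h : ρ.inertia Y) : Y ≅ Y :=
  (c (g * h)).symm ≪≫ ((ρ.mulIso g h (g * h : ρ.inertia Y) rfl).app Y).symm ≪≫
    (ρ.obj g).mapIso (c h) ≪≫ c g

variable [Simple Y]

/-- The factor set (2-cocycle) `α_Y : G_Y × G_Y → kˣ` of a simple object `Y` determined by a choice
of isomorphisms `c^g : ρ^g(Y) ≅ Y`, `g ∈ G_Y`: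
`α_Y(g, h)⁻¹ id_Y = c^g ρ^g(c^h) (ρ₂^{g,h})⁻¹ (c^{gh})⁻¹`. -/
noncomputable def factorSet (c : ∀ g : ρ.inertia Y, (ρ.obj g).obj Y ≅ Y) (g h : ρ.inertia Y) : kˣ :=
  (existsUnique_inv_smul_id k (obstruction ρ Y c g h)).choose

lemma factorSet_spec (c : ∀ g : ρ.inertia Y, (ρ.obj g).obj Y ≅ Y) (g h : ρ.inertia Y) :
    (((factorSet ρ Y c g h)⁻¹ : kˣ) : k) • 𝟙 Y = (obstruction ρ Y c g h).hom :=
  (existsUnique_inv_smul_id k (obstruction ρ Y c g h)).choose_spec.1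

lemma mulIso_comp_eq (c : ∀ g : ρ.inertia Y, (ρ.obj g).obj Y ≅ Y) (g h gh : ρ.inertia Y)
    (e : g * h = gh) (e' : (g : G) * h = gh) :
    (ρ.obj g).map (c h).hom ≫ (c g).hom = (((factorSet ρ Y c g h)⁻¹ : kˣ) : k) •
      ((ρ.mulIso g h gh e').hom.app Y ≫ (c gh).hom) := by
  subst e
  have := factorSet_spec ρ Y c g h
  simp only [obstruction, Iso.trans_hom, Iso.symm_hom, Iso.app_inv, Functor.mapIso_hom] at this
  have h2 := congrArg (fun f => (ρ.mulIso g h (g * h : ρ.inertia Y) e').hom.app Y ≫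
    (c (g * h)).hom ≫ f) this
  simp only [Linear.comp_smul, Category.comp_id, Iso.hom_inv_id_assoc,
    Iso.hom_inv_id_app_assoc] at h2
  exact h2.symm

lemma oneIso_comp_eq (c : ∀ g : ρ.inertia Y, (ρ.obj g).obj Y ≅ Y) :
    ρ.oneIso.hom.app Y ≫ (c 1).hom = (((factorSet ρ Y c 1 1)⁻¹ : kˣ) : k) • 𝟙 Y := by
  have h := mulIso_comp_eq ρ Y c 1 1 1 (mul_one 1) (mul_one 1)
  rw [← Linear.smul_comp, cancel_mono] at h
  have n : (c 1).hom ≫ _ = _ := ρ.oneIso.hom.naturality (c 1).hom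
  have u := ρ.one_mul_unit 1 Y
  rw [← cancel_epi (c 1).hom, reassoc_of% n]
  change ρ.oneIso.hom.app ((ρ.obj 1).obj Y) ≫ (ρ.obj ((1 : ρ.inertia Y) : G)).map (c 1).hom ≫
    (c 1).hom = _
  rw [reassoc_of% h, Linear.smul_comp, Linear.comp_smul]
  erw [reassoc_of% u]
  simp

section

variable (c : ∀ g : ρ.inertia Y, (ρ.obj g).obj Y ≅ Y)
  {V : Type*} [AddCommGroup V] [Module k V] [FiniteDimensional k V]
  (π : ProjRep (factorSet ρ Y c) V)

lemma map_tensorι_tensorIso (g : ρ.inertia Y) (v : V) :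
    (ρ.obj g).map (tensorι (k := k) Y v) ≫
        (mapTensorIso (k := k) (V := V) (ρ.obj g) Y ≪≫ tensorIso (π.toFun g) (c g)).hom =
      (c g).hom ≫ tensorι (k := k) Y (π.toFun g v) := by
  rw [Iso.trans_hom, ← Category.assoc, map_tensorι_mapTensorIso]
  exact tensorι_tensorMap _ _ _

/-- The `G_Y`-equivariant object `V ⊗ Y` with equivariant structure `ν^g = π(g) ⊗ c^g`, attached to
a projective representation `π` of `G_Y` on `V` with factor set `α_Y`. -/
noncomputable def tensorEquivObj : EquivObj (ρ.restrict (ρ.inertia Y)) where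
  X := tensorObj k V Y
  μ g := mapTensorIso (k := k) (V := V) (ρ.obj g) Y ≪≫ tensorIso (π.toFun g) (c g)
  mul := by
    intro g h gh e
    have e' : (g : G) * h = gh := by rw [← e]; rfl
    refine map_tensor_hom_ext (k := k) (V := V) (ρ.obj h ⋙ ρ.obj g) fun v => ?_
    have n : (ρ.obj g).map ((ρ.obj h).map (tensorι (k := k) Y v)) ≫ _ = _ :=
      (ρ.mulIso g h gh e').hom.naturality (tensorι (k := k) Y v)
    change (ρ.obj g).map ((ρ.obj h).map (tensorι (k := k) Y v)) ≫ (ρ.obj g).map _ ≫ _ =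
      (ρ.obj g).map ((ρ.obj h).map (tensorι (k := k) Y v)) ≫ (ρ.mulIso g h gh e').hom.app _ ≫ _
    rw [reassoc_of% n, map_tensorι_tensorIso, ← Functor.map_comp_assoc, map_tensorι_tensorIso,
      Functor.map_comp, Category.assoc, map_tensorι_tensorIso, π.mul, e, map_smul,
      ← Category.assoc, mulIso_comp_eq ρ Y c g h gh e e', Linear.smul_comp, Linear.comp_smul,
      smul_smul]
    simp
  one := by
    refine tensor_hom_ext (k := k) (V := V) fun v => ?_
    have n : tensorι (k := k) Y v ≫ _ = _ := ρ.oneIso.hom.naturality (tensorι (k := k) Y v)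
    have hπ : π.toFun 1 v = (factorSet ρ Y c 1 1 : k) • v := by
      obtain ⟨w, rfl⟩ := (π.toFun 1).surjective v
      rw [π.mul, mul_one]
    have hm := map_tensorι_tensorIso ρ Y c π 1 v
    change tensorι (k := k) Y v ≫ ρ.oneIso.hom.app _ ≫ _ = _
    rw [reassoc_of% n]
    erw [hm]
    rw [← Category.assoc, oneIso_comp_eq, hπ, map_smul, Linear.smul_comp, Linear.comp_smul,
      smul_smul]
    simp

/-- A representative of the class `S_{Y,π}`: the object `L(π ⊗ Y)` of `C^G`. -/
noncomputable def simpleObj [Finite G] (s : G ⧸ ρ.inertia Y → G)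
    (hs : ∀ q, (s q : G ⧸ ρ.inertia Y) = q) : EquivObj ρ :=
  induced ρ s hs (tensorEquivObj ρ Y c π)

end

/-- The operator `f ↦ μ^g ρ^g(f) (c^g)⁻¹` on `Hom_C(Y, X)`, for `(X, μ) ∈ C^G` and `g ∈ G_Y`. -/
def homOperator (c : ∀ g : ρ.inertia Y, (ρ.obj g).obj Y ≅ Y) (A : EquivObj ρ)
    (g : ρ.inertia Y) : (Y ⟶ A.X) →ₗ[k] (Y ⟶ A.X) where
  toFun f := (c g).inv ≫ (ρ.obj g).map f ≫ (A.μ g).hom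
  map_add' f f' := by simp [Functor.map_add]
  map_smul' a f := by simp [Functor.map_smul]

lemma homOperator_mul (c : ∀ g : ρ.inertia Y, (ρ.obj g).obj Y ≅ Y) (A : EquivObj ρ)
    (g h : ρ.inertia Y) (f : Y ⟶ A.X) :
    homOperator ρ Y c A g (homOperator ρ Y c A h f) =
      (factorSet ρ Y c g h : k) • homOperator ρ Y c A (g * h) f := by
  have e' : (g : G) * h = (g * h : ρ.inertia Y) := rfl
  have hA := A.mul g h _ e'
  have n : (ρ.obj g).map ((ρ.obj h).map f) ≫ _ = _ := (ρ.mulIso g h _ e').hom.naturality f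
  have hc := mulIso_comp_eq ρ Y c g h _ rfl e'
  simp only [homOperator, LinearMap.coe_mk, AddHom.coe_mk, Functor.map_comp, Category.assoc]
  rw [hA, reassoc_of% n, ← cancel_epi (c g).hom, Iso.hom_inv_id_assoc,
    ← cancel_epi ((ρ.obj g).map (c h).hom), ← Functor.map_comp_assoc, Iso.hom_inv_id,
    CategoryTheory.Functor.map_id, Category.id_comp, reassoc_of% hc]
  simp [Linear.smul_comp, Linear.comp_smul, smul_smul]

lemma homOperator_bijective (c : ∀ g : ρ.inertia Y, (ρ.obj g).obj Y ≅ Y) (A : EquivObj ρ)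
    (g : ρ.inertia Y) : Function.Bijective (homOperator ρ Y c A g) := by
  have h1 : ∀ f : Y ⟶ A.X, homOperator ρ Y c A 1 f = (factorSet ρ Y c 1 1 : k) • f := by
    intro f
    have n : f ≫ _ = _ := ρ.oneIso.hom.naturality f
    have h := oneIso_comp_eq ρ Y c
    have hc : (c 1).inv = (factorSet ρ Y c 1 1 : k) • ρ.oneIso.hom.app Y := by
      rw [← cancel_mono (c 1).hom, Linear.smul_comp]
      erw [h]
      rw [smul_smul]
      simp
    change (c 1).inv ≫ (ρ.obj 1).map f ≫ (A.μ 1).hom = _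
    rw [hc, Linear.smul_comp]
    erw [← reassoc_of% n, A.one]
    simp
  constructor
  · intro f f' h
    have h' := congrArg (homOperator ρ Y c A g⁻¹) h
    rw [homOperator_mul, homOperator_mul, inv_mul_cancel, h1, h1, smul_smul, smul_smul] at h'
    exact smul_right_injective _ (by simp : ((factorSet ρ Y c g⁻¹ g : k) *
      (factorSet ρ Y c 1 1 : k)) ≠ 0) h'
  · intro f
    refine ⟨((factorSet ρ Y c g g⁻¹ : k) * (factorSet ρ Y c 1 1 : k))⁻¹ •
      homOperator ρ Y c A g⁻¹ f, ?_⟩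
    rw [map_smul, homOperator_mul, mul_inv_cancel, h1, smul_smul, smul_smul, mul_assoc,
      inv_mul_cancel₀ (mul_ne_zero (Units.ne_zero _) (Units.ne_zero _)), one_smul]

/-- The projective representation of `G_Y` with factor set `α_Y` on `Hom_C(Y, X)`, for
`(X, μ) ∈ C^G`, given by `g · f = μ^g ρ^g(f) (c^g)⁻¹`. -/
noncomputable def homRep (c : ∀ g : ρ.inertia Y, (ρ.obj g).obj Y ≅ Y) (A : EquivObj ρ) :
    ProjRep (factorSet ρ Y c) (Y ⟶ A.X) where
  toFun g := LinearEquiv.ofBijective (homOperator ρ Y c A g) (homOperator_bijective ρ Y c A g)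
  mul g h f := homOperator_mul ρ Y c A g h f

end SimpleObjects

end Equivariantization

open Equivariantization

/-! The mechanism is Frobenius reciprocity. A morphism of `C^G` out of an induced object is
determined by its restriction along `N ⟶ L(N)`, and every morphism `N ⟶ Res A` of `C^H` extends
(`frobeniusEquiv`). For `N = V ⊗ Y`, a morphism `V ⊗ Y ⟶ X` of `C` is a linear map `V → Hom(Y, X)`,
and `G_Y`-equivariance of the former is the intertwining property of the latter. Hence `Hom(S, A)`
is the space of intertwiners from `π` to `Hom(Y, A)` (`intertwinerEquiv`), which is the dimension
formula.

For simplicity take `A = S`. If `t` is not in `G_Y`, then `ρ^t Y` is a simple object not isomorphic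
to `Y`, so only the summand at the trivial coset receives nonzero maps from `Y`. As `End Y = k`,
this gives `Hom(Y, S) ≅ V` (`simpleObjι_bijective`), and Schur's lemma for `π` gives `End S = k`
(`end_simpleObj_eq_smul`).

Passing from scalar endomorphisms to simplicity and to split inclusions uses von Neumann regularity
instead of an abelian structure on `C^G`: every `f` has a quasi-inverse `g`, meaning `f ≫ g ≫ f =
f`. This holds in `C` by semisimplicity and passes to `C^G` by averaging over `G` in characteristic
zero. Thus `S` is a constituent of `A` exactly when there is a nonzero `S ⟶ A`, that is, a nonzero
intertwiner. By Maschke's theorem for projective representations, this means that `π` is a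
constituent of `Hom(Y, A)`. -/

namespace Equivariantization

/-! ### Splitting of monomorphisms and von Neumann regularity of `C` -/

section Regularity

variable {C : Type u} [Category.{v} C] [Abelian C]

/-- A monomorphism into a finite direct sum of simple objects splits. -/
theorem exists_retraction_of_mono_biproduct {n : ℕ} (S : Fin n → C) (hS : ∀ i, Simple (S i))
    {A : C} (f : A ⟶ ⨁ S) [Mono f] : ∃ r : ⨁ S ⟶ A, f ≫ r = 𝟙 A := by
  classical
  let e : Finset (Fin n) → (⨁ S ⟶ ⨁ S) := fun J => ∑ j ∈ J, biproduct.π S j ≫ biproduct.ι S j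
  have ιe : ∀ J, ∀ j ∈ J, biproduct.ι S j ≫ e J = biproduct.ι S j := by
    intro J j hj
    simp only [e, Preadditive.comp_sum]
    rw [Finset.sum_eq_single_of_mem j hj]
    · simp
    · intro b _ hb
      rw [biproduct.ι_π_ne_assoc _ (Ne.symm hb), zero_comp]
  have huniv : Mono (f ≫ e Finset.univ) := by
    have : e Finset.univ = 𝟙 _ := IsBilimit.total (biproduct.isBilimit S)
    rw [this, Category.comp_id]
    infer_instance
  -- `e J` projects onto the summands indexed by `J`. For a minimal `J` with `f ≫ e J` still mono,
  -- `f ≫ e J` turns out to identify `A` with the sum of the `S j`, `j ∈ J`.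
  obtain ⟨J, hJ, hmin⟩ := WellFounded.has_min (wellFounded_lt (α := Finset (Fin n)))
    {J | Mono (f ≫ e J)} ⟨_, huniv⟩
  have : Mono (f ≫ e J) := hJ
  -- By minimality, omitting `j` creates a nonzero kernel. On it `f ≫ e J` only has a component in
  -- `S j`, so it embeds in the simple object `S j` and is isomorphic to it; hence the inclusion of
  -- `S j` factors through `f ≫ e J`.
  have key : ∀ j ∈ J, ∃ t : S j ⟶ A, t ≫ f ≫ e J = biproduct.ι S j := by
    intro j hj
    have hsum : e J = biproduct.π S j ≫ biproduct.ι S j + e (J.erase j) :=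
      (Finset.add_sum_erase J _ hj).symm
    have hnot : ¬ Mono (f ≫ e (J.erase j)) := fun h => hmin _ h (Finset.erase_ssubset hj)
    have hne : kernel.ι (f ≫ e (J.erase j)) ≠ 0 := fun h =>
      hnot (Preadditive.mono_of_kernel_zero h)
    have hfac : kernel.ι (f ≫ e (J.erase j)) ≫ f ≫ e J =
        (kernel.ι (f ≫ e (J.erase j)) ≫ f ≫ biproduct.π S j) ≫ biproduct.ι S j := by
      rw [hsum, Preadditive.comp_add, Preadditive.comp_add, kernel.condition, add_zero]
      simp only [Category.assoc]
    have hm' : Mono ((kernel.ι (f ≫ e (J.erase j)) ≫ f ≫ biproduct.π S j) ≫ biproduct.ι S j) := by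
      rw [← hfac]
      infer_instance
    have hm : Mono (kernel.ι (f ≫ e (J.erase j)) ≫ f ≫ biproduct.π S j) :=
      mono_of_mono _ (biproduct.ι S j)
    have h0 : kernel.ι (f ≫ e (J.erase j)) ≫ f ≫ biproduct.π S j ≠ 0 := by
      intro h
      rw [h, zero_comp] at hfac
      exact hne (zero_of_comp_mono _ hfac)
    have := hS j
    have := isIso_of_mono_of_nonzero h0
    refine ⟨inv (kernel.ι (f ≫ e (J.erase j)) ≫ f ≫ biproduct.π S j) ≫
      kernel.ι (f ≫ e (J.erase j)), ?_⟩
    rw [Category.assoc, hfac, IsIso.inv_hom_id_assoc]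
  choose! t ht using key
  refine ⟨e J ≫ ∑ j ∈ J, biproduct.π S j ≫ t j, ?_⟩
  rw [← cancel_mono (f ≫ e J)]
  have h1 : (∑ j ∈ J, biproduct.π S j ≫ t j) ≫ f ≫ e J = e J := by
    rw [Preadditive.sum_comp]
    exact Finset.sum_congr rfl fun j hj => by rw [Category.assoc, ht j hj]
  have h2 : e J ≫ e J = e J := by
    conv_lhs => enter [1]; simp only [e]
    rw [Preadditive.sum_comp]
    exact Finset.sum_congr rfl fun j hj => by rw [Category.assoc, ιe J j hj]
  simp only [Category.assoc] at h1 ⊢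
  rw [h1, h2, Category.id_comp]

theorem exists_retraction_of_mono (k : Type w) [Field k] [Linear k C]
    [IsFiniteSemisimple k C] {A X : C} (f : A ⟶ X) [Mono f] :
    ∃ r : X ⟶ A, f ≫ r = 𝟙 A := by
  obtain ⟨n, S, hS, ⟨i⟩⟩ := IsFiniteSemisimple.semisimple (k := k) X
  obtain ⟨r, hr⟩ := exists_retraction_of_mono_biproduct S hS (f ≫ i.hom)
  exact ⟨i.hom ≫ r, by simpa using hr⟩

/-- A finite semisimple category is von Neumann regular. -/
theorem exists_comp_comp_eq (k : Type w) [Field k] [Linear k C]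
    [IsFiniteSemisimple k C] {X Z : C} (f : X ⟶ Z) : ∃ g : Z ⟶ X, f ≫ g ≫ f = f := by
  -- Splitting the kernel gives a map from the coimage back to `X`, and splitting the mono from the
  -- coimage into `Z` gives `m`. The quasi-inverse is their composite.
  obtain ⟨r, hr⟩ := exists_retraction_of_mono k (kernel.ι f)
  have h : kernel.ι f ≫ (𝟙 X - r ≫ kernel.ι f) = 0 := by
    rw [Preadditive.comp_sub, reassoc_of% hr, Category.comp_id, sub_self]
  obtain ⟨m, hm⟩ := exists_retraction_of_mono k (Abelian.factorThruCoimage f ≫ 𝟙 _)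
  have h1 : Abelian.coimage.π f ≫ cokernel.desc (kernel.ι f) _ h ≫ f = f := by
    rw [cokernel.π_desc_assoc, Preadditive.sub_comp, Category.assoc,
      kernel.condition, comp_zero, sub_zero, Category.id_comp]
  refine ⟨m ≫ cokernel.desc (kernel.ι f) _ h, ?_⟩
  rw [Category.comp_id] at hm
  have h2 : f ≫ m = Abelian.coimage.π f := by
    have h3 := Abelian.coimage.fac f =≫ m
    rwa [Category.assoc, hm, Category.comp_id, eq_comm] at h3
  rw [Category.assoc, reassoc_of% h2, h1]

end Regularity

end Equivariantization
-- Averaging over `G`: regularity of the equivariantization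
namespace Equivariantization

namespace EquivObj

section Averaging

variable {k : Type w} [Field k] {G : Type*} [Group G] {C : Type u} [Category.{v} C]
  [Preadditive C] [Linear k C] {ρ : LinearAction k G C}

/-- The action of `G` on the Hom spaces of `C` between equivariant objects. -/
def conj (A B : EquivObj ρ) (g : G) (u : A.X ⟶ B.X) : A.X ⟶ B.X :=
  (A.μ g).inv ≫ (ρ.obj g).map u ≫ (B.μ g).hom

theorem hom_comm {A B : EquivObj ρ} (f : A ⟶ B) (g : G) :
    (A.μ g).hom ≫ f.1 = (ρ.obj g).map f.1 ≫ (B.μ g).hom :=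
  f.2 g

/-- The structure maps at `a` turn the conjugate by `g` into the conjugate by `a * g`, so summing
over `G` only permutes the terms; this is why `trace` is equivariant. -/
theorem map_conj_comp (A B : EquivObj ρ) (a g : G) (u : A.X ⟶ B.X) :
    (ρ.obj a).map (conj A B g u) ≫ (B.μ a).hom = (A.μ a).hom ≫ conj A B (a * g) u := by
  have n : (ρ.obj a).map ((ρ.obj g).map u) ≫ _ = _ := (ρ.mulIso a g _ rfl).hom.naturality u
  have hA : (ρ.obj a).map (A.μ g).inv ≫ (ρ.mulIso a g _ rfl).hom.app A.X =
      (A.μ a).hom ≫ (A.μ (a * g)).inv := by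
    rw [Iso.eq_comp_inv, Category.assoc, ← A.mul a g _ rfl, ← Functor.map_comp_assoc,
      Iso.inv_hom_id, CategoryTheory.Functor.map_id, Category.id_comp]
  simp only [conj, Functor.map_comp, Category.assoc]
  rw [B.mul a g _ rfl, reassoc_of% n, reassoc_of% hA]

/-- An equivariant `f` commutes with the structure maps and can be moved inside the conjugation.
Conjugates of a quasi-inverse of `f` are therefore again quasi-inverses. -/
theorem comp_conj_comp {A B : EquivObj ρ} (f : A ⟶ B) (g : G) (u : B.X ⟶ A.X) :
    f.1 ≫ conj B A g u ≫ f.1 = conj A B g (f.1 ≫ u ≫ f.1) := by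
  have h : f.1 ≫ (B.μ g).inv = (A.μ g).inv ≫ (ρ.obj g).map f.1 := by
    rw [Iso.comp_inv_eq, Category.assoc, ← hom_comm, Iso.inv_hom_id_assoc]
  simp only [conj, Functor.map_comp, Category.assoc]
  rw [hom_comm, reassoc_of% h]

theorem conj_val {A B : EquivObj ρ} (f : A ⟶ B) (g : G) : conj A B g f.1 = f.1 := by
  rw [conj, ← hom_comm, Iso.inv_hom_id_assoc]

variable [Fintype G]

/-- The sum of all `G`-conjugates of a morphism, as a morphism in `C^G`. -/
def trace (A B : EquivObj ρ) (u : A.X ⟶ B.X) : A ⟶ B :=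
  ⟨∑ g, conj A B g u, fun a => by
    rw [Functor.map_sum, Preadditive.sum_comp, Preadditive.comp_sum]
    simp_rw [map_conj_comp]
    exact (Fintype.sum_equiv (Equiv.mulLeft a) _ _ fun g => rfl).symm⟩

/-- Each of the `|G|` conjugates of `u` is a quasi-inverse of `f` and contributes one copy of `f`.
-/
theorem comp_trace_comp {A B : EquivObj ρ} (f : A ⟶ B) (u : B.X ⟶ A.X)
    (h : f.1 ≫ u ≫ f.1 = f.1) : f ≫ trace B A u ≫ f = (Fintype.card G : k) • f := by
  apply Subtype.ext
  change f.1 ≫ (∑ g, conj B A g u) ≫ f.1 = (Fintype.card G : k) • f.1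
  rw [Preadditive.sum_comp, Preadditive.comp_sum]
  simp_rw [comp_conj_comp, h, conj_val]
  rw [Finset.sum_const, Finset.card_univ, Nat.cast_smul_eq_nsmul]

end Averaging

/-- The equivariantization of a finite semisimple category in characteristic zero is von Neumann
regular. -/
theorem exists_comp_comp_eq {k : Type w} [Field k] [CharZero k] {G : Type*} [Group G] [Finite G]
    {C : Type u} [Category.{v} C] [Abelian C] [Linear k C] [IsFiniteSemisimple k C]
    {ρ : LinearAction k G C} {A B : EquivObj ρ} (f : A ⟶ B) : ∃ g : B ⟶ A, f ≫ g ≫ f = f := by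
  have := Fintype.ofFinite G
  obtain ⟨u, hu⟩ := Equivariantization.exists_comp_comp_eq k f.1
  refine ⟨(Fintype.card G : k)⁻¹ • trace B A u, ?_⟩
  rw [Linear.smul_comp, Linear.comp_smul, comp_trace_comp f u hu, smul_smul,
    inv_mul_cancel₀ (by simp), one_smul]

end EquivObj

end Equivariantization
-- Frobenius reciprocity for the induced object
namespace Equivariantization

section Frobenius

variable {k : Type w} [Field k] {G : Type*} [Group G] {C : Type u} [Category.{v} C]
  [Preadditive C] [Linear k C] {ρ : LinearAction k G C} {H : Subgroup G}

/-- The restriction of an equivariant object to a subgroup. -/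
def EquivObj.res (A : EquivObj ρ) (H : Subgroup G) : EquivObj (ρ.restrict H) where
  X := A.X
  μ h := A.μ h
  mul g h gh e := A.mul g h gh (by rw [← e]; rfl)
  one := A.one

/-- The structure isomorphisms of an `H`-equivariant object, in terms of the action of `G`. -/
def EquivObj.ν (N : EquivObj (ρ.restrict H)) (h : H) : (ρ.obj (h : G)).obj N.X ≅ N.X := N.μ h

theorem EquivObj.ν_mul (N : EquivObj (ρ.restrict H)) (g h gh : H) (e : (g : G) * h = gh) :
    (ρ.obj (g : G)).map (N.ν h).hom ≫ (N.ν g).hom =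
      (ρ.mulIso g h gh e).hom.app N.X ≫ (N.ν gh).hom :=
  N.mul g h gh (Subtype.ext e)

theorem inducedComponent_hom (N : EquivObj (ρ.restrict H)) (g t r : G) (h : H)
    (e : r * (h : G) = g * t) : (inducedComponent ρ N g t r h e).hom =
      (ρ.mulIso g t (g * t) rfl).hom.app N.X ≫ (ρ.mulIso r h (g * t) e).inv.app N.X ≫
        (ρ.obj r).map (N.ν h).hom := rfl

/-- Both sides are `ρ₂^{h,t}` followed by `ν^{ht}`. Thus, for a representative `t` lying in `H`, the
map `ν^t` identifies the summand `ρ^t N` with `N` compatibly with `H`. -/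
theorem map_ν_comp_ν (N : EquivObj (ρ.restrict H)) (t h h' : H) (e : (t : G) * h' = h * t) :
    (ρ.obj (h : G)).map (N.ν t).hom ≫ (N.ν h).hom =
      (inducedComponent ρ N h t t h' e).hom ≫ (N.ν t).hom := by
  rw [inducedComponent_hom, Category.assoc, Category.assoc, N.ν_mul t h' (h * t) e,
    N.ν_mul h t (h * t) rfl]
  exact congrArg _ (Iso.inv_hom_id_app_assoc _ _ _).symm

/-- Both sides are `ρ₂^{a,t}`, then `ρ^{at}(f)`, then `μ^{at}`: one uses the factorization `a * t`,
the other `r * h`, where `hf` absorbs `ν^h`. This is the equivariance of the map glued from the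
`ρ^t(f) ≫ μ^t`. -/
theorem inducedComponent_comp (N : EquivObj (ρ.restrict H)) (A : EquivObj ρ) (f : N.X ⟶ A.X)
    (hf : ∀ h : H, (N.ν h).hom ≫ f = (ρ.obj (h : G)).map f ≫ (A.μ h).hom) (a t r : G) (h : H)
    (e : r * (h : G) = a * t) :
    (inducedComponent ρ N a t r h e).hom ≫ (ρ.obj r).map f ≫ (A.μ r).hom =
      (ρ.obj a).map ((ρ.obj t).map f) ≫ (ρ.obj a).map (A.μ t).hom ≫ (A.μ a).hom := by
  have n : (ρ.obj a).map ((ρ.obj t).map f) ≫ _ = _ := (ρ.mulIso a t _ rfl).hom.naturality f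
  have n' : (ρ.obj r).map ((ρ.obj (h : G)).map f) ≫ _ = _ := (ρ.mulIso r h _ e).hom.naturality f
  rw [A.mul a t _ rfl, reassoc_of% n, inducedComponent_hom, Category.assoc, Category.assoc,
    ← Functor.map_comp_assoc, hf, Functor.map_comp, Category.assoc, A.mul r h _ e, reassoc_of% n']
  exact congrArg _ (Iso.inv_hom_id_app_assoc _ _ _)

variable [HasFiniteBiproducts C] [Finite G] (s : G ⧸ H → G) (hs : ∀ q, (s q : G ⧸ H) = q)
  (N : EquivObj (ρ.restrict H))

/-- Equivariance may be tested on summands because the additive functor `ρ^a` preserves the direct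
sum. -/
theorem mem_homSubmodule_induced_iff (A : EquivObj ρ)
    (f : (⨁ fun q : G ⧸ H => (ρ.obj (s q)).obj N.X) ⟶ A.X) :
    f ∈ EquivObj.homSubmodule (induced ρ s hs N) A ↔ ∀ a q,
      (inducedComponent ρ N a (s q) (s (a • q)) (cosetElement s hs a q)
        (by simp [cosetElement])).hom ≫
          biproduct.ι (fun q : G ⧸ H => (ρ.obj (s q)).obj N.X) (a • q) ≫ f =
        (ρ.obj a).map (biproduct.ι (fun q : G ⧸ H => (ρ.obj (s q)).obj N.X) q ≫ f) ≫
          (A.μ a).hom := by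
  change (∀ a, (inducedIso ρ s hs N a).hom ≫ f = (ρ.obj a).map f ≫ (A.μ a).hom) ↔ _
  refine forall_congr' fun a => ?_
  have key : ∀ q, (ρ.obj a).map (biproduct.ι (fun q : G ⧸ H => (ρ.obj (s q)).obj N.X) q) ≫
      (inducedIso ρ s hs N a).hom ≫ f = _ := fun q => by
    rw [← Category.assoc, map_ι_inducedIso, Category.assoc]
  simp_rw [← key, Functor.map_comp, Category.assoc]
  exact ⟨fun h q => by rw [h], fun h => map_biproduct_hom_ext _ (ρ.obj a) h⟩

/-- The representative of the trivial coset, as an element of the subgroup. -/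
def baseElement : H :=
  ⟨s ((1 : G) : G ⧸ H), by
    have h := QuotientGroup.eq.mp (hs ((1 : G) : G ⧸ H)).symm
    simpa using h⟩

/-- The identification of `N` with its twist by the representative of the trivial coset. -/
def baseIso : (ρ.obj (s ((1 : G) : G ⧸ H))).obj N.X ≅ N.X := N.ν (baseElement s hs)

/-- The inclusion of `N` into the induced object, as a morphism of `C`. -/
noncomputable def inducedUnit : N.X ⟶ ⨁ fun q : G ⧸ H => (ρ.obj (s q)).obj N.X :=
  (baseIso s hs N).inv ≫
    biproduct.ι (fun q : G ⧸ H => (ρ.obj (s q)).obj N.X) ((1 : G) : G ⧸ H)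

/-- The representative of the trivial coset need not be `1`, so the summand there is only a twist of
`N` by an element of `H`; `baseIso` undoes this twist. -/
theorem ι_comp_eq (A : EquivObj ρ) (f : (⨁ fun q : G ⧸ H => (ρ.obj (s q)).obj N.X) ⟶ A.X) :
    biproduct.ι (fun q : G ⧸ H => (ρ.obj (s q)).obj N.X) ((1 : G) : G ⧸ H) ≫ f =
      (baseIso s hs N).hom ≫ inducedUnit s hs N ≫ f := by
  rw [inducedUnit, Category.assoc, Iso.hom_inv_id_assoc]

/-- Elements of `H` fix the trivial coset, so equivariance of `f` under `H` restricts to that one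
summand. -/
theorem inducedUnit_comp_comm (A : EquivObj ρ)
    (f : (⨁ fun q : G ⧸ H => (ρ.obj (s q)).obj N.X) ⟶ A.X)
    (hf : f ∈ EquivObj.homSubmodule (induced ρ s hs N) A) (h : H) :
    (N.ν h).hom ≫ inducedUnit s hs N ≫ f =
      (ρ.obj (h : G)).map (inducedUnit s hs N ≫ f) ≫ (A.μ h).hom := by
  have hq : (h : G) • ((1 : G) : G ⧸ H) = ((1 : G) : G ⧸ H) := by
    change (((h : G) * 1 : G) : G ⧸ H) = ((1 : G) : G ⧸ H)
    rw [QuotientGroup.eq]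
    simp
  -- With `t` the representative of the trivial coset, the element of `H` occurring in the component
  -- is `t⁻¹ h t`.
  have e' : s ((1 : G) : G ⧸ H) * (((baseElement s hs)⁻¹ * (h * baseElement s hs) : H) : G) =
      h * s ((1 : G) : G ⧸ H) := by
    change (baseElement s hs : G) * _ = (h : G) * baseElement s hs
    simp
  have h1 := (mem_homSubmodule_induced_iff s hs N A f).mp hf h ((1 : G) : G ⧸ H)
  rw [← Category.assoc, inducedComponent_ι ρ s N h _ hq _ _ _ e', Category.assoc,
    ι_comp_eq s hs, Functor.map_comp, Category.assoc] at h1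
  have h2 : (ρ.obj (h : G)).map (baseIso s hs N).hom ≫ (N.ν h).hom =
      (inducedComponent ρ N h _ _ _ e').hom ≫ (baseIso s hs N).hom := map_ν_comp_ν N _ h _ e'
  rw [← reassoc_of% h2, cancel_epi] at h1
  exact h1

/-- Restriction along the inclusion of `N` into the induced object. -/
noncomputable def frobenius (A : EquivObj ρ) :
    (induced ρ s hs N ⟶ A) →ₗ[k] (N ⟶ A.res H) where
  toFun f := ⟨inducedUnit s hs N ≫ f.1, inducedUnit_comp_comm s hs N A f.1 f.2⟩
  map_add' _ _ := Subtype.ext (Preadditive.comp_add _ _ _ _ _ _)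
  map_smul' _ _ := Subtype.ext (Linear.comp_smul _ _ _ _ _ _)

/-- `G` permutes the cosets transitively and the components are isomorphisms, so an equivariant map
vanishing on the trivial summand vanishes on all of them. -/
theorem frobenius_injective (A : EquivObj ρ) : Function.Injective (frobenius s hs N A) := by
  rw [← LinearMap.ker_eq_bot, LinearMap.ker_eq_bot']
  rintro ⟨(f : (⨁ fun q : G ⧸ H => (ρ.obj (s q)).obj N.X) ⟶ A.X), hf⟩ h
  have h0 : inducedUnit s hs N ≫ f = 0 := congrArg Subtype.val h
  have hf' := (mem_homSubmodule_induced_iff s hs N A f).mp hf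
  suffices f = 0 from Subtype.ext this
  refine biproduct.hom_ext' _ _ fun q => ?_
  obtain ⟨a, rfl⟩ : ∃ a : G, a • ((1 : G) : G ⧸ H) = q := by
    obtain ⟨a, rfl⟩ := QuotientGroup.mk_surjective q
    exact ⟨a, congrArg QuotientGroup.mk (mul_one a)⟩
  have h1 := hf' a ((1 : G) : G ⧸ H)
  rw [ι_comp_eq s hs, h0, comp_zero, Functor.map_zero, zero_comp] at h1
  rw [comp_zero]
  exact (Preadditive.IsIso.comp_left_eq_zero _ _).mp h1

theorem frobenius_surjective (A : EquivObj ρ) : Function.Surjective (frobenius s hs N A) := by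
  rintro ⟨(g : N.X ⟶ A.X), hg⟩
  replace hg : ∀ h : H, (N.ν h).hom ≫ g = (ρ.obj (h : G)).map g ≫ (A.μ h).hom := hg
  -- The extension of `g` sends the summand `ρ^t N` to `A` by `ρ^t(g)` followed by `μ^t`.
  let f : (⨁ fun q : G ⧸ H => (ρ.obj (s q)).obj N.X) ⟶ A.X :=
    biproduct.desc fun q => (ρ.obj (s q)).map g ≫ (A.μ (s q)).hom
  have hf : ∀ q, biproduct.ι (fun q : G ⧸ H => (ρ.obj (s q)).obj N.X) q ≫ f =
    (ρ.obj (s q)).map g ≫ (A.μ (s q)).hom := fun q => biproduct.ι_desc _ _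
  refine ⟨⟨f, (mem_homSubmodule_induced_iff s hs N A f).mpr fun a q => ?_⟩, Subtype.ext ?_⟩
  · have e : s (a • q) * (cosetElement s hs a q : G) = a * s q := by simp [cosetElement]
    rw [hf, hf, Functor.map_comp, Category.assoc]
    exact inducedComponent_comp N A g hg a (s q) _ _ e
  · change inducedUnit s hs N ≫ f = g
    rw [inducedUnit, Category.assoc, hf, Iso.inv_comp_eq]
    exact (hg (baseElement s hs)).symm

/-- Frobenius reciprocity. -/
noncomputable def frobeniusEquiv (A : EquivObj ρ) :
    (induced ρ s hs N ⟶ A) ≃ₗ[k] (N ⟶ A.res H) :=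
  LinearEquiv.ofBijective _ ⟨frobenius_injective s hs N A, frobenius_surjective s hs N A⟩

end Frobenius

/-! ### Morphisms out of `V ⊗ Y` as intertwiners -/

section Intertwiners

variable {k : Type w} [Field k] [IsAlgClosed k] {G : Type*} [Group G] {C : Type u}
  [Category.{v} C] [Abelian C] [Linear k C] [IsFiniteSemisimple k C]
  {ρ : LinearAction k G C} {Y : C} [Simple Y] {c : ∀ g : ρ.inertia Y, (ρ.obj g).obj Y ≅ Y}
  {V : Type*} [AddCommGroup V] [Module k V] [FiniteDimensional k V]
  (π : ProjRep (factorSet ρ Y c) V)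

/-- A morphism `V ⊗ Y ⟶ Z` amounts to a linear map `V → Hom(Y, Z)`. -/
noncomputable def tensorHomEquiv (k : Type*) [Field k] {C : Type u} [Category.{v} C]
    [Preadditive C] [Linear k C] [HasFiniteBiproducts C] (V : Type*) [AddCommGroup V] [Module k V]
    [FiniteDimensional k V] (Y Z : C) : (tensorObj k V Y ⟶ Z) ≃ₗ[k] (V →ₗ[k] (Y ⟶ Z)) where
  toFun f := Linear.rightComp k Y f ∘ₗ tensorι Y
  invFun φ := biproduct.desc fun i => φ (Module.finBasis k V i)
  map_add' f f' := by ext v; simp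
  map_smul' a f := by ext v; simp
  left_inv f := by
    refine biproduct.hom_ext' _ _ fun i => ?_
    simp [tensorι_basis]
  right_inv φ := by
    refine (Module.finBasis k V).ext fun i => ?_
    simp [tensorι_basis]

theorem tensorHomEquiv_apply (k : Type*) [Field k] {C : Type u} [Category.{v} C]
    [Preadditive C] [Linear k C] [HasFiniteBiproducts C] {V : Type*} [AddCommGroup V] [Module k V]
    [FiniteDimensional k V] {Y Z : C} (f : tensorObj k V Y ⟶ Z) (v : V) :
    tensorHomEquiv k V Y Z f v = tensorι Y v ≫ f := rfl

theorem homRep_apply (A : EquivObj ρ) (g : ρ.inertia Y) (f : Y ⟶ A.X) :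
    (homRep ρ Y c A).toFun g f = (c g).inv ≫ (ρ.obj g).map f ≫ (A.μ g).hom := rfl

/-- Equality of maps out of `ρ^g(V ⊗ Y)` can be tested on the `ρ^g(v ⊗ -)`. There equivariance
becomes the intertwining relation at `v`, after moving the isomorphism `c^g` to the other side. -/
theorem mem_homSubmodule_iff (A : EquivObj ρ) (f : tensorObj k V Y ⟶ A.X) :
    f ∈ EquivObj.homSubmodule (tensorEquivObj ρ Y c π) (A.res (ρ.inertia Y)) ↔
      tensorHomEquiv k V Y A.X f ∈ π.intertwiners (homRep ρ Y c A) := by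
  change (∀ g : ρ.inertia Y, _ = _) ↔ ∀ g v, _ = _
  refine forall_congr' fun g => ?_
  have key : ∀ v : V, (tensorHomEquiv k V Y A.X f (π.toFun g v) =
      (homRep ρ Y c A).toFun g (tensorHomEquiv k V Y A.X f v)) ↔
      (ρ.obj g).map (tensorι (k := k) Y v) ≫ ((tensorEquivObj ρ Y c π).μ g).hom ≫ f =
        (ρ.obj g).map (tensorι (k := k) Y v) ≫ (ρ.obj g).map f ≫ (A.μ g).hom := by
    intro v
    have h := map_tensorι_tensorIso ρ Y c π g v
    rw [homRep_apply, tensorHomEquiv_apply, tensorHomEquiv_apply, Iso.eq_inv_comp]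
    erw [reassoc_of% h]
    rw [Functor.map_comp, Category.assoc]
  simp_rw [key]
  exact ⟨fun h v => congrArg (_ ≫ ·) h, fun h => map_tensor_hom_ext (k := k) (V := V) (ρ.obj g) h⟩

/-- `Hom(V ⊗ Y, A)` in `C^{G_Y}` is the space of intertwiners `V → Hom(Y, A)`. -/
noncomputable def tensorIntertwinerEquiv (A : EquivObj ρ) :
    (tensorEquivObj ρ Y c π ⟶ A.res (ρ.inertia Y)) ≃ₗ[k] π.intertwiners (homRep ρ Y c A) :=
  (tensorHomEquiv k V Y A.X).ofSubmodules _ _ (by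
    ext φ
    obtain ⟨f, rfl⟩ := (tensorHomEquiv k V Y A.X).surjective φ
    refine Iff.trans ?_ (mem_homSubmodule_iff π A f)
    exact (Submodule.mem_map_equiv (e := tensorHomEquiv k V Y A.X) _).trans
      (by rw [LinearEquiv.symm_apply_apply]; exact Iff.rfl))

variable [Finite G] (s : G ⧸ ρ.inertia Y → G) (hs : ∀ q, (s q : G ⧸ ρ.inertia Y) = q)

/-- The vector `v` as a morphism from `Y` to `S_{Y,π}`. -/
noncomputable def simpleObjι : V →ₗ[k] (Y ⟶ (simpleObj ρ Y c π s hs).X) :=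
  tensorHomEquiv k V Y _ (inducedUnit s hs (tensorEquivObj ρ Y c π))

/-- `Hom(S_{Y,π}, A)` in `C^G` is the space of intertwiners `V → Hom(Y, A)`. -/
noncomputable def intertwinerEquiv (A : EquivObj ρ) :
    (simpleObj ρ Y c π s hs ⟶ A) ≃ₗ[k] π.intertwiners (homRep ρ Y c A) :=
  frobeniusEquiv s hs (tensorEquivObj ρ Y c π) A ≪≫ₗ tensorIntertwinerEquiv π A

theorem intertwinerEquiv_apply (A : EquivObj ρ) (f : simpleObj ρ Y c π s hs ⟶ A) (v : V) :
    (intertwinerEquiv π s hs A f).1 v = simpleObjι π s hs v ≫ f.1 :=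
  (Category.assoc _ _ _).symm

end Intertwiners

end Equivariantization
-- Endomorphisms and simplicity of `S_{Y,π}`
namespace Equivariantization

/-- The functors of an action of a group are equivalences. -/
theorem LinearAction.isEquivalence {k : Type w} [Field k] {G : Type*} [Group G] {C : Type u}
    [Category.{v} C] [Preadditive C] [Linear k C] (ρ : LinearAction k G C) (g : G) :
    (ρ.obj g).IsEquivalence :=
  (CategoryTheory.Equivalence.mk (ρ.obj g) (ρ.obj g⁻¹)
    (ρ.oneIso ≪≫ (ρ.mulIso g⁻¹ g 1 (inv_mul_cancel g)).symm)
    (ρ.mulIso g g⁻¹ 1 (mul_inv_cancel g) ≪≫ ρ.oneIso.symm)).isEquivalence_functor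

namespace ProjRep

theorem IsIrreducible.nontrivial {k : Type*} [Field k] {H : Type*} [Group H] {α : H → H → kˣ}
    {V : Type*} [AddCommGroup V] [Module k V] {π : ProjRep α V} (hπ : π.IsIrreducible) :
    Nontrivial V :=
  (Submodule.nontrivial_iff k).mp (nontrivial_of_ne _ _ hπ.2.1)

variable {k : Type*} [Field k] [IsAlgClosed k] {H : Type*} [Group H] {α : H → H → kˣ}
  {V : Type*} [AddCommGroup V] [Module k V] [FiniteDimensional k V]

/-- Schur's lemma for projective representations. -/
theorem IsIrreducible.exists_eq_smul {π : ProjRep α V} (hπ : π.IsIrreducible) {T : V →ₗ[k] V}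
    (hT : T ∈ π.intertwiners π) : ∃ a : k, ∀ v, T v = a • v := by
  have := hπ.nontrivial
  -- An eigenspace of an intertwiner is invariant; being nonzero, it is all of `V`.
  obtain ⟨a, ha⟩ := Module.End.exists_eigenvalue T
  refine ⟨a, fun v => ?_⟩
  have hinv : π.IsInvariant (Module.End.eigenspace T a) := fun g x hx => by
    rw [Module.End.mem_eigenspace_iff] at hx ⊢
    rw [hT g x, hx, map_smul]
  have htop := (hπ.2.2 _ le_top hinv).resolve_left ha
  exact Module.End.mem_eigenspace_iff.mp (htop ▸ Submodule.mem_top (x := v))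

end ProjRep

section Schur

/-- `ρ^g Y` is simple because `ρ^g` is an equivalence. A nonzero coordinate of `f` would be an
isomorphism `Y ≅ ρ^g Y`, forcing `g` into the inertia subgroup. -/
theorem eq_zero_of_notMem_inertia {k : Type w} [Field k] {G : Type*} [Group G] {C : Type u}
    [Category.{v} C] [Abelian C] [Linear k C] {ρ : LinearAction k G C} {Y : C} [Simple Y]
    (V : Type*) [AddCommGroup V] [Module k V] [FiniteDimensional k V] {g : G}
    (hg : g ∉ ρ.inertia Y) (f : Y ⟶ (ρ.obj g).obj (tensorObj k V Y)) : f = 0 := by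
  have := ρ.isEquivalence g
  have := simple_obj (ρ.obj g) Y
  rw [← cancel_mono (mapTensorIso (k := k) (V := V) (ρ.obj g) Y).hom, zero_comp]
  refine biproduct.hom_ext _ _ fun i => ?_
  rw [zero_comp]
  by_contra h
  have := isIso_of_hom_simple h
  exact hg ⟨(asIso ((f ≫ (mapTensorIso (k := k) (V := V) (ρ.obj g) Y).hom) ≫
    biproduct.π (fun _ : Fin (Module.finrank k V) => (ρ.obj g).obj Y) i)).symm⟩

variable {k : Type w} [Field k] [IsAlgClosed k] {G : Type*} [Group G] {C : Type u}
  [Category.{v} C] [Abelian C] [Linear k C] [IsFiniteSemisimple k C]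

/-- Since `End Y = k`, a map from `Y` to a sum of copies of `Y` is a tuple of scalars, namely the
coordinates of a vector of `V`. -/
theorem tensorι_bijective (k : Type w) [Field k] [IsAlgClosed k] [Linear k C]
    [IsFiniteSemisimple k C] (V : Type*) [AddCommGroup V] [Module k V] [FiniteDimensional k V]
    (Y : C) [Simple Y] : Function.Bijective (tensorι Y : V →ₗ[k] (Y ⟶ tensorObj k V Y)) := by
  set b := Module.finBasis k V
  have hπ : ∀ (v : V) i, tensorι Y v ≫ biproduct.π (fun _ : Fin (Module.finrank k V) => Y) i =
      b.repr v i • 𝟙 Y := by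
    intro v i
    rw [tensorι, Module.Basis.constr_apply_fintype, Preadditive.sum_comp,
      Finset.sum_eq_single_of_mem i (Finset.mem_univ i)]
    · rw [Linear.smul_comp, biproduct.ι_π_self, Module.Basis.equivFun_apply]
    · intro j _ hj
      rw [Linear.smul_comp, biproduct.ι_π_ne _ hj, smul_zero]
  constructor
  · rw [← LinearMap.ker_eq_bot, LinearMap.ker_eq_bot']
    intro v hv
    refine b.ext_elem fun i => ?_
    have h := hπ v i
    rw [hv, zero_comp] at h
    rw [map_zero, Finsupp.zero_apply]
    exact (smul_eq_zero.mp h.symm).resolve_right (id_nonzero Y)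
  · intro f
    choose a ha using fun i => endomorphism_simple_eq_smul_id k
      (f ≫ biproduct.π (fun _ : Fin (Module.finrank k V) => Y) i)
    refine ⟨b.equivFun.symm a, biproduct.hom_ext _ _ fun i => ?_⟩
    rw [hπ, ← ha, ← Module.Basis.equivFun_apply, LinearEquiv.apply_symm_apply]

variable {ρ : LinearAction k G C} {Y : C} [Simple Y]
  {c : ∀ g : ρ.inertia Y, (ρ.obj g).obj Y ≅ Y}

variable {V : Type*} [AddCommGroup V] [Module k V] [FiniteDimensional k V]
  (π : ProjRep (factorSet ρ Y c) V)
  [Finite G] (s : G ⧸ ρ.inertia Y → G) (hs : ∀ q, (s q : G ⧸ ρ.inertia Y) = q)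

/-- All summands of `S` at nontrivial cosets receive only zero from `Y`, and the remaining summand
is a copy of `V ⊗ Y`. -/
theorem simpleObjι_bijective : Function.Bijective (simpleObjι π s hs) := by
  let X : G ⧸ ρ.inertia Y → C := fun q => (ρ.obj (s q)).obj (tensorObj k V Y)
  let e : (ρ.obj (s ((1 : G) : G ⧸ ρ.inertia Y))).obj (tensorObj k V Y) ≅ tensorObj k V Y :=
    baseIso s hs (tensorEquivObj ρ Y c π)
  have hι : ∀ v, simpleObjι π s hs v =
      tensorι Y v ≫ e.inv ≫ biproduct.ι X ((1 : G) : G ⧸ ρ.inertia Y) := fun v => rfl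
  constructor
  · intro v v' h
    have h' : tensorι Y v ≫ e.inv ≫ biproduct.ι X ((1 : G) : G ⧸ ρ.inertia Y) =
      tensorι Y v' ≫ e.inv ≫ biproduct.ι X ((1 : G) : G ⧸ ρ.inertia Y) := h
    rw [cancel_mono] at h'
    exact (tensorι_bijective k V Y).1 h'
  · intro (f : Y ⟶ ⨁ X)
    obtain ⟨v, hv⟩ := (tensorι_bijective k V Y).2
      (f ≫ biproduct.π X ((1 : G) : G ⧸ ρ.inertia Y) ≫ e.hom)
    refine ⟨v, ?_⟩
    rw [hι, hv]
    refine biproduct.hom_ext _ _ fun q => ?_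
    simp only [Category.assoc, Iso.hom_inv_id_assoc]
    by_cases hq : q = ((1 : G) : G ⧸ ρ.inertia Y)
    · subst hq
      rw [biproduct.ι_π_self, Category.comp_id]
    · have hsq : s q ∉ ρ.inertia Y := fun h => hq (by
        rw [← hs q, QuotientGroup.eq]
        simpa using h)
      exact (eq_zero_of_notMem_inertia V hsq _).trans (eq_zero_of_notMem_inertia V hsq _).symm

variable {π} in
-- Reciprocity with `A = S` turns `f` into an intertwiner `V → Hom(Y, S)`. Transported along `V ≅
-- Hom(Y, S)` it becomes a self-intertwiner of `π`, hence a scalar.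
theorem end_simpleObj_eq_smul (hπ : π.IsIrreducible)
    (f : simpleObj ρ Y c π s hs ⟶ simpleObj ρ Y c π s hs) : ∃ a : k, f = a • 𝟙 _ := by
  let σ := homRep ρ Y c (simpleObj ρ Y c π s hs)
  let E : V ≃ₗ[k] (Y ⟶ (simpleObj ρ Y c π s hs).X) :=
    LinearEquiv.ofBijective _ (simpleObjι_bijective π s hs)
  let Φ := intertwinerEquiv π s hs (simpleObj ρ Y c π s hs)
  -- `E` is the intertwiner attached to the identity of `S`; this is where its compatibility with
  -- the actions comes from.
  have hE : ∀ v, E v = (Φ (𝟙 _)).1 v := fun v => by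
    rw [intertwinerEquiv_apply]
    exact (Category.comp_id _).symm
  have hT : E.symm.toLinearMap ∘ₗ (Φ f).1 ∈ π.intertwiners π := by
    intro g v
    apply E.injective
    rw [hE (π.toFun g _), (Φ (𝟙 _)).2 g, ← hE]
    simp only [LinearMap.comp_apply, LinearEquiv.coe_coe, LinearEquiv.apply_symm_apply]
    exact (Φ f).2 g v
  obtain ⟨a, ha⟩ := hπ.exists_eq_smul hT
  refine ⟨a, Φ.injective (Subtype.ext (LinearMap.ext fun v => ?_))⟩
  have h := congrArg E (ha v)
  rw [map_smul, LinearMap.comp_apply, LinearEquiv.coe_coe, LinearEquiv.apply_symm_apply, hE] at h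
  rw [map_smul]
  exact h

variable {π} in
theorem id_simpleObj_ne_zero (hπ : π.IsIrreducible) : 𝟙 (simpleObj ρ Y c π s hs) ≠ 0 := by
  intro h
  have := hπ.nontrivial
  obtain ⟨v, hv⟩ := exists_ne (0 : V)
  apply hv
  apply (simpleObjι_bijective π s hs).1
  have h1 := intertwinerEquiv_apply π s hs (simpleObj ρ Y c π s hs) (𝟙 _) v
  rw [map_zero, ← Category.comp_id (simpleObjι π s hs v)]
  refine h1.symm.trans ?_
  rw [h, map_zero]
  rfl

variable [CharZero k] {π}

/-- For a quasi-inverse `g` of `f`, the endomorphism `f ≫ g` of `S` is a scalar `a` with `(a - 1) •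
f = 0`, so `a = 1`. -/
theorem exists_retraction_of_ne_zero (hπ : π.IsIrreducible) {A : EquivObj ρ}
    {f : simpleObj ρ Y c π s hs ⟶ A} (hf : f ≠ 0) :
    ∃ g : A ⟶ simpleObj ρ Y c π s hs, f ≫ g = 𝟙 _ := by
  obtain ⟨g, hg⟩ := EquivObj.exists_comp_comp_eq f
  obtain ⟨a, ha⟩ := end_simpleObj_eq_smul s hs hπ (f ≫ g)
  refine ⟨g, ?_⟩
  rw [← Category.assoc, ha, Linear.smul_comp, Category.id_comp] at hg
  have h1 : (a - 1) • f = 0 := by rw [sub_smul, hg, one_smul, sub_self]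
  rw [ha, sub_eq_zero.mp ((smul_eq_zero.mp h1).resolve_right hf), one_smul]

/-- A quasi-inverse `g` of a mono `f` satisfies `f ≫ g = 𝟙`. On the other side `g ≫ f` is a scalar
endomorphism of `S`, equal to `1` when `f ≠ 0`. -/
theorem simple_simpleObj (hπ : π.IsIrreducible) : Simple (simpleObj ρ Y c π s hs) where
  mono_isIso_iff_nonzero {B} f _ := by
    constructor
    · rintro _ rfl
      apply id_simpleObj_ne_zero s hs hπ
      rw [← IsIso.inv_hom_id (0 : B ⟶ simpleObj ρ Y c π s hs), comp_zero]
    · intro hf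
      obtain ⟨g, hg⟩ := EquivObj.exists_comp_comp_eq f
      have h1 : f ≫ g = 𝟙 B := by rw [← cancel_mono f, Category.assoc, hg, Category.id_comp]
      obtain ⟨a, ha⟩ := end_simpleObj_eq_smul s hs hπ (g ≫ f)
      have h2 : (a - 1) • f = 0 := by
        rw [ha, Linear.comp_smul, Category.comp_id] at hg
        rw [sub_smul, hg, one_smul, sub_self]
      rw [sub_eq_zero.mp ((smul_eq_zero.mp h2).resolve_right hf), one_smul] at ha
      exact ⟨g, h1, ha⟩

end Schur

end Equivariantization
-- Complete reducibility of projective representations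
namespace Equivariantization

namespace ProjRep

section Maschke

variable {k : Type*} [Field k] {H : Type*} [Group H] {α : H → H → kˣ}
  {W : Type*} [AddCommGroup W] [Module k W] (σ : ProjRep α W)

/-- The action of `H` on the endomorphisms of a projective representation. -/
def conj (g : H) (T : W →ₗ[k] W) : W →ₗ[k] W :=
  (σ.toFun g).toLinearMap ∘ₗ T ∘ₗ (σ.toFun g).symm.toLinearMap

theorem conj_apply (g : H) (T : W →ₗ[k] W) (x : W) :
    σ.conj g T (σ.toFun g x) = σ.toFun g (T x) := by
  simp [conj]

/-- The same scalar `α(a, g)` appears on both sides, so conjugation behaves as for an ordinary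
representation and the usual averaging applies. -/
theorem toFun_conj (a g : H) (T : W →ₗ[k] W) (x : W) :
    σ.toFun a (σ.conj g T x) = σ.conj (a * g) T (σ.toFun a x) := by
  obtain ⟨y, rfl⟩ := (σ.toFun g).surjective x
  rw [conj_apply, σ.mul, σ.mul, map_smul, conj_apply]

variable {σ}

/-- `σ(g)` maps `U` injectively into itself, hence onto itself by finite dimension. -/
theorem IsInvariant.symm_mem [FiniteDimensional k W] {U : Submodule k W} (hU : σ.IsInvariant U)
    (g : H) {x : W} (hx : x ∈ U) : (σ.toFun g).symm x ∈ U := by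
  have h : U.map (σ.toFun g).toLinearMap = U :=
    Submodule.eq_of_le_of_finrank_eq (Submodule.map_le_iff_le_comap.mpr fun y hy => hU g y hy)
      (LinearEquiv.finrank_map_eq (σ.toFun g) U)
  rw [← h] at hx
  obtain ⟨y, hy, rfl⟩ := hx
  simpa using hy

/-- Maschke's theorem for projective representations. -/
theorem IsInvariant.exists_isCompl [CharZero k] [Finite H] [FiniteDimensional k W]
    {U : Submodule k W} (hU : σ.IsInvariant U) : ∃ U', σ.IsInvariant U' ∧ IsCompl U U' := by
  have := Fintype.ofFinite H
  obtain ⟨p, hp⟩ := U.subtype.exists_leftInverse_of_injective U.ker_subtype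
  -- `q` is the unnormalized average of a projection onto `U`: it has values in `U` and is
  -- multiplication by `|H|` on `U`. The invariant complement is its kernel.
  let q : W →ₗ[k] W := ∑ g, σ.conj g (U.subtype ∘ₗ p)
  have hq : ∀ x, q x = ∑ g, σ.conj g (U.subtype ∘ₗ p) x := fun x => LinearMap.sum_apply _ _ _
  have hqU : ∀ x, q x ∈ U := fun x => by
    rw [hq]
    exact U.sum_mem fun g _ => hU g _ (p _).2
  have hqid : ∀ x ∈ U, q x = (Fintype.card H : k) • x := fun x hx => by
    have : ∀ g, σ.conj g (U.subtype ∘ₗ p) x = x := fun g => by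
      have h := LinearMap.congr_fun hp ⟨_, hU.symm_mem g hx⟩
      change σ.toFun g (p ((σ.toFun g).symm x)) = x
      erw [h]
      simp
    rw [hq, Finset.sum_congr rfl fun g _ => this g, Finset.sum_const, Finset.card_univ,
      Nat.cast_smul_eq_nsmul]
  have hcard : (Fintype.card H : k) ≠ 0 := by simp
  refine ⟨LinearMap.ker q, fun a x hx => ?_, ?_, ?_⟩
  · rw [LinearMap.mem_ker] at hx ⊢
    have h := congrArg (σ.toFun a) hx
    rw [hq, map_sum, map_zero] at h
    simp_rw [toFun_conj] at h
    rw [hq, ← h]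
    exact (Fintype.sum_equiv (Equiv.mulLeft a) _ _ fun g => rfl).symm
  · rw [Submodule.disjoint_def]
    intro x hx hx'
    rw [LinearMap.mem_ker, hqid x hx] at hx'
    exact (smul_eq_zero.mp hx').resolve_left hcard
  · rw [codisjoint_iff, Submodule.eq_top_iff']
    intro x
    rw [← add_sub_cancel ((Fintype.card H : k)⁻¹ • q x) x]
    refine Submodule.add_mem_sup (U.smul_mem _ (hqU x)) ?_
    rw [LinearMap.mem_ker, map_sub, map_smul, hqid _ (hqU x), smul_smul, inv_mul_cancel₀ hcard,
      one_smul, sub_self]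

theorem IsInvariant.finset_sup {T : Finset (Submodule k W)} (hT : ∀ U ∈ T, σ.IsInvariant U) :
    σ.IsInvariant (T.sup id) := by
  refine Finset.sup_induction (p := σ.IsInvariant) ?_ ?_ hT
  · rintro g x hx
    rw [Submodule.mem_bot] at hx ⊢
    rw [hx, map_zero]
  · intro U hU U' hU' g x hx
    obtain ⟨y, hy, z, hz, rfl⟩ := Submodule.mem_sup.mp hx
    rw [map_add]
    exact Submodule.add_mem_sup (hU g y hy) (hU' g z hz)

/-- A minimal nonzero invariant subspace of `U` is irreducible. -/
theorem IsInvariant.exists_irreducible_le [FiniteDimensional k W] {U : Submodule k W}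
    (hU : σ.IsInvariant U) (h0 : U ≠ ⊥) : ∃ U' ≤ U, σ.IsIrreducibleSub U' := by
  obtain ⟨U', ⟨hle, hinv, hne⟩, hmin⟩ := WellFounded.has_min
    (wellFounded_lt (α := Submodule k W)) {U' | U' ≤ U ∧ σ.IsInvariant U' ∧ U' ≠ ⊥}
    ⟨U, le_rfl, hU, h0⟩
  refine ⟨U', hle, hinv, hne, fun U'' hle' hinv' => ?_⟩
  by_contra! h
  exact hmin U'' ⟨hle'.trans hle, hinv', h.1⟩ (lt_of_le_of_ne hle' h.2)

/-- Complete reducibility: an irreducible subrepresentation is a summand in a decomposition into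
irreducible subrepresentations. -/
theorem IsIrreducibleSub.exists_decomposition [CharZero k] [Finite H] [FiniteDimensional k W]
    {U₀ : Submodule k W} (hU₀ : σ.IsIrreducibleSub U₀) :
    ∃ (n : ℕ) (U : Fin n → Submodule k W), DirectSum.IsInternal U ∧
      (∀ i, σ.IsIrreducibleSub (U i)) ∧ ∃ i, U i = U₀ := by
  classical
  -- Among independent finite families of irreducible subspaces containing `U₀`, take one whose sum
  -- is maximal. If the sum were proper, an irreducible subspace of an invariant complement would
  -- enlarge it.
  obtain ⟨_, ⟨T, ⟨hmem, hirr, hind⟩, rfl⟩, hmax⟩ := WellFounded.has_min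
    (wellFounded_gt (α := Submodule k W))
    ((fun T : Finset (Submodule k W) => T.sup id) ''
      {T | U₀ ∈ T ∧ (∀ U ∈ T, σ.IsIrreducibleSub U) ∧ T.SupIndep id})
    ⟨_, {U₀}, by simpa using hU₀, rfl⟩
  have htop : T.sup id = ⊤ := by
    by_contra hne
    obtain ⟨U', hU', hcompl⟩ :=
      (IsInvariant.finset_sup fun U hU => (hirr U hU).1).exists_isCompl
    have h0 : U' ≠ ⊥ := by
      rintro rfl
      exact hne (by simpa using hcompl.sup_eq_top)
    obtain ⟨U₁, hle, hU₁⟩ := hU'.exists_irreducible_le h0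
    have hdisj : Disjoint U₁ (T.sup id) := (hcompl.disjoint.mono_right hle).symm
    refine hmax _ ⟨insert U₁ T, ⟨Finset.mem_insert_of_mem hmem, ?_, ?_⟩, rfl⟩ ?_
    · exact (Finset.forall_mem_insert _ _ _).mpr ⟨hU₁, hirr⟩
    · exact hind.insert hdisj
    · change T.sup id < (insert U₁ T).sup id
      rw [Finset.sup_insert, id, right_lt_sup]
      exact fun h => hU₁.2.1 (hdisj.eq_bot_of_le h)
  let e := T.equivFin
  refine ⟨T.card, fun i => (e.symm i : Submodule k W), ?_, fun i => hirr _ (e.symm i).2,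
    e ⟨U₀, hmem⟩, by simp⟩
  rw [DirectSum.isInternal_submodule_iff_iSupIndep_and_iSup_eq_top]
  constructor
  · exact ((iSupIndep_comp_coe_iff_supIndep.mpr hind)).comp e.symm.injective
  · rw [← htop, Finset.sup_eq_iSup, e.symm.iSup_comp (g := fun U : T => (U : Submodule k W)),
      iSup_subtype]
    rfl

/-- A nonzero intertwiner from an irreducible `π` has zero kernel, so its image is an irreducible
copy of `π`, and complete reducibility extends that image to a full decomposition. -/
theorem isConstituentOf_iff [CharZero k] [Finite H] [FiniteDimensional k W] {V : Type*}
    [AddCommGroup V] [Module k V] {π : ProjRep α V} (hπ : π.IsIrreducible) :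
    π.IsConstituentOf σ ↔ ∃ φ ∈ π.intertwiners σ, φ ≠ 0 := by
  constructor
  · rintro ⟨n, U, -, -, i, φ, hφ⟩
    refine ⟨(U i).subtype ∘ₗ φ.toLinearMap, hφ, fun h => ?_⟩
    have := hπ.nontrivial
    obtain ⟨v, hv⟩ := exists_ne (0 : V)
    apply hv
    apply φ.injective
    rw [map_zero]
    exact Subtype.ext (LinearMap.congr_fun h v)
  · rintro ⟨φ, hφ, h0⟩
    have hker : LinearMap.ker φ = ⊥ := by
      refine (hπ.2.2 (LinearMap.ker φ) le_top fun g x hx => ?_).resolve_right fun h =>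
        h0 (LinearMap.ker_eq_top.mp h)
      rw [LinearMap.mem_ker] at hx ⊢
      rw [hφ g x, hx, map_zero]
    have hinj := LinearMap.ker_eq_bot.mp hker
    have hirr : σ.IsIrreducibleSub (LinearMap.range φ) := by
      refine ⟨?_, fun h => h0 (LinearMap.range_eq_bot.mp h), fun U hle hU => ?_⟩
      · rintro g _ ⟨x, rfl⟩
        exact ⟨π.toFun g x, hφ g x⟩
      · have hinv : π.IsInvariant (U.comap φ) := fun g x hx => by
          rw [Submodule.mem_comap] at hx ⊢
          rw [hφ g x]
          exact hU g _ hx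
        rw [← Submodule.map_comap_eq_self hle]
        rcases hπ.2.2 _ le_top hinv with h | h <;> rw [h]
        · exact Or.inl (Submodule.map_bot φ)
        · exact Or.inr (Submodule.map_top φ)
    obtain ⟨n, U, hU, hU', i, hi⟩ := hirr.exists_decomposition
    exact ⟨n, U, hU, hU', i, (LinearEquiv.ofInjective φ hinj).trans (LinearEquiv.ofEq _ _ hi.symm),
      hφ⟩

end Maschke

end ProjRep

end Equivariantization

/-! ### The main theorem -/

theorem proposition2p16 {k : Type w} [Field k] [IsAlgClosed k] [CharZero k]
    {C : Type u} [Category.{v} C] [Abelian C] [Linear k C] [IsFiniteSemisimple k C]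
    {G : Type*} [Group G] [Finite G] (ρ : LinearAction k G C)
    (Y : C) [Simple Y] (c : ∀ g : ρ.inertia Y, (ρ.obj g).obj Y ≅ Y)
    (s : G ⧸ ρ.inertia Y → G) (hs : ∀ q, (s q : G ⧸ ρ.inertia Y) = q)
    {V : Type*} [AddCommGroup V] [Module k V] [FiniteDimensional k V]
    (π : ProjRep (factorSet ρ Y c) V) (hπ : π.IsIrreducible) (A : EquivObj ρ) :
    Simple (simpleObj ρ Y c π s hs) ∧
    Module.finrank k (simpleObj ρ Y c π s hs ⟶ A) = π.multiplicity (homRep ρ Y c A) ∧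
    (IsConstituent (simpleObj ρ Y c π s hs) A ↔ π.IsConstituentOf (homRep ρ Y c A)) := by
  have hsimple := simple_simpleObj s hs hπ
  let Φ := intertwinerEquiv π s hs A
  refine ⟨hsimple, Φ.finrank_eq, ?_⟩
  rw [ProjRep.isConstituentOf_iff hπ]
  constructor
  · rintro ⟨-, ⟨r⟩⟩
    -- The inclusion of a retract is nonzero because the identity of `S` is, and `Φ` is injective.
    refine ⟨(Φ r.i).1, (Φ r.i).2, fun h => ?_⟩
    have h0 : r.i = 0 := Φ.map_eq_zero_iff.mp (Subtype.ext h)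
    apply id_simpleObj_ne_zero s hs hπ
    rw [← r.retract, h0, zero_comp]
  · rintro ⟨φ, hφ, h0⟩
    -- Conversely a nonzero intertwiner comes from a nonzero morphism `S ⟶ A`, which splits.
    have hf : Φ.symm ⟨φ, hφ⟩ ≠ 0 := fun h =>
      h0 (congrArg Subtype.val (Φ.symm.map_eq_zero_iff.mp h))
    obtain ⟨g, hg⟩ := exists_retraction_of_ne_zero s hs hπ hf
    exact ⟨hsimple, ⟨⟨_, g, hg⟩⟩⟩
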